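/- **Lemma 2.3.** Let $\mathbb R^{N}_{s}$ be $\mathbb R^N$ with the inner product $\langle\xi,\eta\rangle=-\sum_{i\le s}\xi_i\eta_i+\sum_{i>s}\xi_i\eta_i$, and let $\mathbb Q^{n+1}_1=\{[\xi]\in\mathbb RP^{n+2}\mid \langle\xi,\xi\rangle=0\}$ be the conformal space of null lines of $\mathbb R^{n+3}_2$. Let $x:\mathbf M\to\mathbb Q^{n+1}_1$ be a space-like hypersurface, that is, $\mathbf M$ is a smooth $n$-manifold, $x$ is smooth, and $\langle dy,dy\rangle$ is positive definite for every smooth local lift $y$ of $x$ to $\mathbb R^{n+3}_2\setminus\{0\}$. Let $\Delta$ and $\kappa$ denote the Laplacian and the normalized scalar curvature (the scalar curvature divided by $n(n-1)$) of $\langle dy,dy\rangle$. The conformal metric is $$g=-\big(\langle\Delta y,\Delta y\rangle-n^2\kappa\big)\,\langle dy,dy\rangle ,$$ which does not depend on the local lift $y$, and $x$ is called regular if $g$ is nondegenerate. Suppose that $x$ is regular. A canonical lift is a local lift $Y$, unique up to sign, with $\langle dY,dY\rangle=g$; put $$N=-\tfrac1n\Delta Y-\tfrac1{2n^2}\langle\Delta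 Y,\Delta Y\rangle Y ,$$ and let $\xi$ be a smooth local field, unique up to sign, with $\langle\xi,\xi\rangle=-1$ that is orthogonal to $Y$, $N$ and $dY$. The Blaschke tensor is $\mathbb A=\langle dN,dY\rangle=\sum A_{ij}\,\omega^i\otimes\omega^j$, the conformal second fundamental form is $\mathbb B=\langle d\xi,dY\rangle=\sum B_{ij}\,\omega^i\otimes\omega^j$ (defined up to sign), and the Blaschke eigenvalues are the eigenvalues of $\mathbb A$ with respect to $g$. A tensor is called parallel if its covariant differential with respect to the Levi-Civita connection of $g$ vanishes. If the Blaschke tensor $\mathbb A$ of the regular space-like hypersurface $x$ is parallel ($A_{ij,k}=0$ for all $i,j,k$) and $x$ has exactly three distinct Blaschke eigenvalues at every point of $\mathbf M$, then the conformal second fundamental form $\mathbb B$ is parallel ($B_{ij,k}=0$ for all $i,j,k$). -/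

import Mathlib

open scoped Manifold ContDiff LinearAlgebra.Projectivization

noncomputable section

namespace ConformalGeometry

/-! ### The pseudo-Euclidean space and the conformal space -/

/-- The inner product of the pseudo-Euclidean space `ℝ^m_s`: the first `s` coordinates carry the
sign `-1`, the others the sign `+1`. -/
def pseudoInner (s : ℕ) {m : ℕ} (v w : Fin m → ℝ) : ℝ :=
  ∑ i : Fin m, (if (i : ℕ) < s then (-1 : ℝ) else 1) * (v i * w i)

/-- The conformal space (projective light cone) `ℚ^m_s`: the null lines of `ℝ^{m+2}_{s+1}`, as a
subset of the real projective space of dimension `m + 1`. -/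
def ConformalSpace (m s : ℕ) : Set (ℙ ℝ (Fin (m + 2) → ℝ)) :=
  {p | ∀ (v : Fin (m + 2) → ℝ) (hv : v ≠ 0),
    p = Projectivization.mk ℝ v hv → pseudoInner (s + 1) v v = 0}

/-! ### Riemannian geometry in coordinates

A metric or a covariant 2-tensor on an open subset of `ℝⁿ` is given by the matrix of its
components. -/

/-- The partial derivative `∂ᵢ f` at `u`. -/
def pd {n : ℕ} {F : Type*} [NormedAddCommGroup F] [NormedSpace ℝ F] (i : Fin n)
    (f : EuclideanSpace ℝ (Fin n) → F) (u : EuclideanSpace ℝ (Fin n)) : F :=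
  fderiv ℝ f u (EuclideanSpace.single i (1 : ℝ))

/-- The Christoffel symbols `Γᵏᵢⱼ = ½ gᵏˡ (∂ᵢ gⱼₗ + ∂ⱼ gᵢₗ - ∂ₗ gᵢⱼ)` of the metric `g`. -/
def christoffel {n : ℕ} (g : EuclideanSpace ℝ (Fin n) → Matrix (Fin n) (Fin n) ℝ)
    (k i j : Fin n) (u : EuclideanSpace ℝ (Fin n)) : ℝ :=
  (1 / 2) * ∑ l, (g u)⁻¹ k l *
    (pd i (fun v => g v j l) u + pd j (fun v => g v i l) u - pd l (fun v => g v i j) u)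

/-- The Ricci tensor
`Rⱼₖ = ∂ᵢ Γⁱⱼₖ - ∂ⱼ Γⁱᵢₖ + Γⁱᵢₚ Γᵖⱼₖ - Γⁱⱼₚ Γᵖᵢₖ` of the metric `g`
(it is positive for round spheres). -/
def ricci {n : ℕ} (g : EuclideanSpace ℝ (Fin n) → Matrix (Fin n) (Fin n) ℝ)
    (j k : Fin n) (u : EuclideanSpace ℝ (Fin n)) : ℝ :=
  ∑ i, (pd i (christoffel g i j k) u - pd j (christoffel g i i k) u
    + ∑ p, (christoffel g i i p u * christoffel g p j k u
      - christoffel g i j p u * christoffel g p i k u))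

/-- The normalized scalar curvature `κ = gʲᵏ Rⱼₖ / (n (n - 1))` of the metric `g`. -/
def normalizedScalarCurvature {n : ℕ}
    (g : EuclideanSpace ℝ (Fin n) → Matrix (Fin n) (Fin n) ℝ)
    (u : EuclideanSpace ℝ (Fin n)) : ℝ :=
  (∑ j, ∑ k, (g u)⁻¹ j k * ricci g j k u) / ((n : ℝ) * ((n : ℝ) - 1))

/-- The Laplacian `Δ f = gⁱʲ (∂ᵢ ∂ⱼ f - Γᵏᵢⱼ ∂ₖ f)` of a vector-valued function with respect to the
metric `g`. -/
def laplacian {n : ℕ} {F : Type*} [NormedAddCommGroup F] [NormedSpace ℝ F]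
    (g : EuclideanSpace ℝ (Fin n) → Matrix (Fin n) (Fin n) ℝ)
    (f : EuclideanSpace ℝ (Fin n) → F) (u : EuclideanSpace ℝ (Fin n)) : F :=
  ∑ i, ∑ j, (g u)⁻¹ i j • (pd i (pd j f) u - ∑ k, christoffel g k i j u • pd k f u)

/-- The components `Tᵢⱼ,ₖ = ∂ₖ Tᵢⱼ - Γˡₖᵢ Tₗⱼ - Γˡₖⱼ Tᵢₗ` of the covariant differential of the
covariant 2-tensor `T` with respect to the Levi-Civita connection of the metric `g`. -/
def covDeriv {n : ℕ} (g T : EuclideanSpace ℝ (Fin n) → Matrix (Fin n) (Fin n) ℝ)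
    (i j k : Fin n) (u : EuclideanSpace ℝ (Fin n)) : ℝ :=
  pd k (fun v => T v i j) u
    - ∑ l, (christoffel g l k i u * T u l j + christoffel g l k j u * T u i l)

/-! ### Local lifts and the conformal invariants

In this part `y` (or `Y`) is a map from an open subset of `ℝⁿ` to the light cone of
`ℝ^{n+3}_2`, that is, a local lift of a hypersurface of `ℚ^{n+1}_1` written in a chart. -/

/-- The first fundamental form `⟨dy, dy⟩`. -/
def inducedMetric {n : ℕ} (y : EuclideanSpace ℝ (Fin n) → (Fin (n + 1 + 2) → ℝ))
    (u : EuclideanSpace ℝ (Fin n)) : Matrix (Fin n) (Fin n) ℝ :=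
  Matrix.of fun i j => pseudoInner 2 (pd i y u) (pd j y u)

/-- The factor `e^{2τ} = -(⟨Δy, Δy⟩ - n² κ)`, with `Δ` and `κ` those of the metric `⟨dy, dy⟩`.
(The sign is that of the timelike normal; for a hypersurface of a Lorentzian space form, lifted in
the usual way, this is `(n ∑ hⁱⱼ hʲᵢ - (∑ hⁱᵢ)²) / (n - 1)`.) -/
def conformalFactor {n : ℕ} (y : EuclideanSpace ℝ (Fin n) → (Fin (n + 1 + 2) → ℝ))
    (u : EuclideanSpace ℝ (Fin n)) : ℝ :=
  -(pseudoInner 2 (laplacian (inducedMetric y) y u) (laplacian (inducedMetric y) y u)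
    - (n : ℝ) ^ 2 * normalizedScalarCurvature (inducedMetric y) u)

/-- The conformal metric `-(⟨Δy, Δy⟩ - n² κ) ⟨dy, dy⟩`; it is the same for all local lifts. -/
def conformalMetric {n : ℕ} (y : EuclideanSpace ℝ (Fin n) → (Fin (n + 1 + 2) → ℝ))
    (u : EuclideanSpace ℝ (Fin n)) : Matrix (Fin n) (Fin n) ℝ :=
  conformalFactor y u • inducedMetric y u

/-- The second null vector `N = -(1/n) ΔY - (1/(2n²)) ⟨ΔY, ΔY⟩ Y` of the conformal frame of a
canonical lift `Y`; it satisfies `⟨Y, N⟩ = 1`, `⟨N, N⟩ = 0` and `⟨N, dY⟩ = 0`. -/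
def conformalN {n : ℕ} (Y : EuclideanSpace ℝ (Fin n) → (Fin (n + 1 + 2) → ℝ))
    (u : EuclideanSpace ℝ (Fin n)) : Fin (n + 1 + 2) → ℝ :=
  (-(1 / (n : ℝ))) • laplacian (inducedMetric Y) Y u
    - ((1 / (2 * (n : ℝ) ^ 2)) * pseudoInner 2 (laplacian (inducedMetric Y) Y u)
        (laplacian (inducedMetric Y) Y u)) • Y u

/-- The Blaschke tensor `𝔸 = ⟨dN, dY⟩` of a canonical lift `Y`. -/
def blaschkeTensor {n : ℕ} (Y : EuclideanSpace ℝ (Fin n) → (Fin (n + 1 + 2) → ℝ))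
    (u : EuclideanSpace ℝ (Fin n)) : Matrix (Fin n) (Fin n) ℝ :=
  Matrix.of fun i j => pseudoInner 2 (pd i (conformalN Y) u) (pd j Y u)

/-- `ξ` is a smooth conformal normal field on `U`: a timelike unit field orthogonal to
`Y`, `N` and `dY`. It is unique up to sign. -/
def IsConformalNormal {n : ℕ} (U : Set (EuclideanSpace ℝ (Fin n)))
    (Y ξ : EuclideanSpace ℝ (Fin n) → (Fin (n + 1 + 2) → ℝ)) : Prop :=
  ContDiffOn ℝ ∞ ξ U ∧ ∀ u ∈ U,
    pseudoInner 2 (ξ u) (ξ u) = -1 ∧ pseudoInner 2 (ξ u) (Y u) = 0 ∧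
    pseudoInner 2 (ξ u) (conformalN Y u) = 0 ∧ ∀ i, pseudoInner 2 (ξ u) (pd i Y u) = 0

/-- The conformal second fundamental form `𝔹 = ⟨dξ, dY⟩` of a canonical lift `Y` with conformal
normal field `ξ`. -/
def secondForm {n : ℕ} (Y ξ : EuclideanSpace ℝ (Fin n) → (Fin (n + 1 + 2) → ℝ))
    (u : EuclideanSpace ℝ (Fin n)) : Matrix (Fin n) (Fin n) ℝ :=
  Matrix.of fun i j => pseudoInner 2 (pd i ξ u) (pd j Y u)

/-! ### Hypersurfaces of the conformal space `ℚ^{n+1}_1` -/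

section Hypersurface

variable {n : ℕ} {M : Type*} [TopologicalSpace M] [ChartedSpace (EuclideanSpace ℝ (Fin n)) M]

/-- `y`, a smooth map on the open subset `U` of the range of the smooth chart `e` of `M`, is a local
lift of `x`, written in the chart: `x = [y]`. -/
def IsLocalLift (x : M → ConformalSpace (n + 1) 1)
    (e : OpenPartialHomeomorph M (EuclideanSpace ℝ (Fin n)))
    (U : Set (EuclideanSpace ℝ (Fin n)))
    (y : EuclideanSpace ℝ (Fin n) → (Fin (n + 1 + 2) → ℝ)) : Prop :=
  e ∈ IsManifold.maximalAtlas (𝓡 n) ∞ M ∧ IsOpen U ∧ U ⊆ e.target ∧ ContDiffOn ℝ ∞ y U ∧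
    ∀ u ∈ U, ∃ h : y u ≠ 0, (x (e.symm u) : ℙ ℝ (Fin (n + 1 + 2) → ℝ)) = Projectivization.mk ℝ (y u) h

/-- `x` is smooth: around every point of `M` it has a smooth local lift. -/
def IsSmooth (x : M → ConformalSpace (n + 1) 1) : Prop :=
  ∀ p : M, ∃ e U y, IsLocalLift x e U y ∧ p ∈ e.source ∧ e p ∈ U

/-- `x` is a space-like hypersurface: it is smooth and the metric `⟨dy, dy⟩` of each
local lift is positive definite (in particular `x` is an immersion). -/
def IsSpacelikeHypersurface (x : M → ConformalSpace (n + 1) 1) : Prop :=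
  IsSmooth x ∧ ∀ e U y, IsLocalLift x e U y → ∀ u ∈ U, (inducedMetric y u).PosDef

/-- `x` is regular: its conformal metric is nondegenerate. -/
def IsRegular (x : M → ConformalSpace (n + 1) 1) : Prop :=
  ∀ e U y, IsLocalLift x e U y → ∀ u ∈ U, (conformalMetric y u).det ≠ 0

/-- `Y` is a canonical lift of `x`: a local lift whose first fundamental form is the conformal
metric. It is unique up to sign. -/
def IsCanonicalLift (x : M → ConformalSpace (n + 1) 1)
    (e : OpenPartialHomeomorph M (EuclideanSpace ℝ (Fin n)))
    (U : Set (EuclideanSpace ℝ (Fin n)))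
    (Y : EuclideanSpace ℝ (Fin n) → (Fin (n + 1 + 2) → ℝ)) : Prop :=
  IsLocalLift x e U Y ∧ ∀ u ∈ U, inducedMetric Y u = conformalMetric Y u

/-- The Blaschke tensor of `x` is parallel with respect to the conformal metric: `Aᵢⱼ,ₖ = 0`. -/
def HasParallelBlaschkeTensor (x : M → ConformalSpace (n + 1) 1) : Prop :=
  ∀ e U Y, IsCanonicalLift x e U Y → ∀ u ∈ U, ∀ i j k,
    covDeriv (conformalMetric Y) (blaschkeTensor Y) i j k u = 0

/-- At every point of `M` there are exactly `c` distinct Blaschke eigenvalues, the real eigenvalues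
of `(Aⁱⱼ)`, the Blaschke tensor with an index raised by the conformal metric. -/
def HasBlaschkeEigenvalueCount (x : M → ConformalSpace (n + 1) 1) (c : ℕ) : Prop :=
  ∀ e U Y, IsCanonicalLift x e U Y → ∀ u ∈ U,
    {a : ℝ | Module.End.HasEigenvalue
      (Matrix.toLin' ((conformalMetric Y u)⁻¹ * blaschkeTensor Y u)) a}.encard = c

/-- The conformal second fundamental form of `x` is parallel with respect to the conformal metric:
`Bᵢⱼ,ₖ = 0`. (The choices of sign of `Y` and `ξ` do not matter.) -/
def HasParallelSecondForm (x : M → ConformalSpace (n + 1) 1) : Prop :=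
  ∀ e U Y ξ, IsCanonicalLift x e U Y → IsConformalNormal U Y ξ → ∀ u ∈ U, ∀ i j k,
    covDeriv (conformalMetric Y) (secondForm Y ξ) i j k u = 0

end Hypersurface

end ConformalGeometry

end

noncomputable section

namespace ConformalGeometry

/-! ### The pseudo-Euclidean inner product as a bilinear form -/

/-! In a chart, take a canonical lift Y with metric g = ⟨dY, dY⟩ and put a = g⁻¹A, b = g⁻¹B, Cᵢ =
⟨∂ᵢN, ξ⟩. The frame Y, N, ∂ᵢY, ξ spans the ambient space, and comparing mixed partial derivatives
gives equations of Gauss, Codazzi and Ricci type. This calculus needs only a null, spacelike lift.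

If B vanished at a point, the Gauss equation would make the conformal factor vanish there
(`conformalFactor_eq_zero`), which is impossible for a canonical lift. For parallel A the Codazzi
equation reads Bₖⱼ Cᵢ = Bᵢⱼ Cₖ; since tr b = 0 and B ≠ 0, this forces C = 0
(`conformalForm_eq_zero`). The Ricci equation then says that a and b commute (`raise_commute`).

Since a is parallel, the curvature commutes with a (`curvature_commute`). Let X be an eigenvector of
a for l, and let V, Z be eigenvectors for m ≠ l. By the Gauss equation R(X,V)Z lies in the
l-eigenspace, by commutation in the m-eigenspace, so it vanishes: ⟨bV,Z⟩ bX = (l+m)⟨V,Z⟩ X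
(`mixed_curvature`). With three distinct eigenvalues this forces b to be a nonzero scalar βᵢ on the
lᵢ-eigenspace, with βᵢβⱼ = lᵢ + lⱼ. Hence b((l₁+l₂+l₃) - a) = p for the scalar p = β₁β₂β₃, and p² =
(l₁+l₂)(l₁+l₃)(l₂+l₃) (`exists_mul_eq_smul_one`).

The eigenvalues of the parallel field a are locally constant (`exists_ball_eigenvalues`), so p² is
too, and hence the smooth nonvanishing function p. Thus b is a constant multiple of the inverse of a
parallel field, and is parallel. -/

/-- `pseudoInner` as a bilinear form. -/
def pseudoForm (s m : ℕ) : (Fin m → ℝ) →ₗ[ℝ] (Fin m → ℝ) →ₗ[ℝ] ℝ :=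
  LinearMap.mk₂ ℝ (fun v w => pseudoInner s v w)
    (fun v v' w => by
      simp only [pseudoInner, Pi.add_apply, ← Finset.sum_add_distrib]
      exact Finset.sum_congr rfl fun i _ => by ring)
    (fun c v w => by
      simp only [pseudoInner, Pi.smul_apply, smul_eq_mul, Finset.mul_sum]
      exact Finset.sum_congr rfl fun i _ => by ring)
    (fun v w w' => by
      simp only [pseudoInner, Pi.add_apply, ← Finset.sum_add_distrib]
      exact Finset.sum_congr rfl fun i _ => by ring)
    (fun c v w => by
      simp only [pseudoInner, Pi.smul_apply, smul_eq_mul, Finset.mul_sum]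
      exact Finset.sum_congr rfl fun i _ => by ring)

theorem pseudoInner_eq_form (s : ℕ) {m : ℕ} (v w : Fin m → ℝ) :
    pseudoInner s v w = pseudoForm s m v w := rfl

theorem pseudoForm_comm (s m : ℕ) (v w : Fin m → ℝ) :
    pseudoForm s m v w = pseudoForm s m w v := by
  simp only [← pseudoInner_eq_form, pseudoInner]
  exact Finset.sum_congr rfl fun i _ => by ring

/-! ### Partial derivatives of smooth maps -/

section Calculus

variable {n : ℕ} {F : Type*} [NormedAddCommGroup F] [NormedSpace ℝ F]
  {U : Set (EuclideanSpace ℝ (Fin n))} {u : EuclideanSpace ℝ (Fin n)}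

theorem contDiffOn_pd (hU : IsOpen U) {f : EuclideanSpace ℝ (Fin n) → F}
    (hf : ContDiffOn ℝ ∞ f U) (i : Fin n) : ContDiffOn ℝ ∞ (pd i f) U :=
  (hf.fderiv_of_isOpen hU (m := ∞) (by simp)).clm_apply contDiffOn_const

theorem differentiableAt_of_contDiffOn (hU : IsOpen U) {f : EuclideanSpace ℝ (Fin n) → F}
    (hf : ContDiffOn ℝ ∞ f U) (hu : u ∈ U) : DifferentiableAt ℝ f u :=
  (hf.contDiffAt (hU.mem_nhds hu)).differentiableAt (by simp)

theorem pd_congr_of_eqOn (hU : IsOpen U) {f g : EuclideanSpace ℝ (Fin n) → F}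
    (h : Set.EqOn f g U) (hu : u ∈ U) (i : Fin n) : pd i f u = pd i g u := by
  have : f =ᶠ[nhds u] g := Filter.eventually_of_mem (hU.mem_nhds hu) h
  simp only [pd, this.fderiv_eq]

theorem pd_const (c : F) (i : Fin n) : pd i (fun _ => c) u = 0 := by
  simp [pd]

theorem pd_eq_zero_of_eqOn_const (hU : IsOpen U) {f : EuclideanSpace ℝ (Fin n) → F} {c : F}
    (h : ∀ v ∈ U, f v = c) (hu : u ∈ U) (i : Fin n) : pd i f u = 0 := by
  rw [pd_congr_of_eqOn hU (g := fun _ => c) h hu, pd_const]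

theorem pd_comm (hU : IsOpen U) {f : EuclideanSpace ℝ (Fin n) → F}
    (hf : ContDiffOn ℝ ∞ f U) (hu : u ∈ U) (i j : Fin n) :
    pd i (pd j f) u = pd j (pd i f) u := by
  have hd : DifferentiableAt ℝ (fderiv ℝ f) u :=
    differentiableAt_of_contDiffOn hU (hf.fderiv_of_isOpen hU (m := ∞) (by simp)) hu
  have key : ∀ i j : Fin n, pd i (pd j f) u =
      fderiv ℝ (fderiv ℝ f) u (EuclideanSpace.single i 1) (EuclideanSpace.single j 1) := by
    intro i j
    have := (hd.hasFDerivAt.clm_apply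
      (hasFDerivAt_const (EuclideanSpace.single j (1 : ℝ)) u)).fderiv
    change fderiv ℝ (fun v => fderiv ℝ f v (EuclideanSpace.single j 1)) u _ = _
    rw [this]
    simp
  rw [key, key]
  refine ((hf.contDiffAt (hU.mem_nhds hu)).isSymmSndFDerivAt ?_).eq _ _
  simpa using (mod_cast le_top : ((2 : ℕ∞) : WithTop ℕ∞) ≤ ∞)

theorem pd_sub {f g : EuclideanSpace ℝ (Fin n) → F} (hf : DifferentiableAt ℝ f u)
    (hg : DifferentiableAt ℝ g u) (i : Fin n) :
    pd i (fun v => f v - g v) u = pd i f u - pd i g u := by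
  simp only [pd]
  rw [(hf.hasFDerivAt.fun_sub hg.hasFDerivAt).fderiv]; rfl

theorem pd_sum {ι : Type*} (t : Finset ι) {f : ι → EuclideanSpace ℝ (Fin n) → F}
    (hf : ∀ k ∈ t, DifferentiableAt ℝ (f k) u) (i : Fin n) :
    pd i (fun v => ∑ k ∈ t, f k v) u = ∑ k ∈ t, pd i (f k) u := by
  simp only [pd]
  rw [(HasFDerivAt.fun_sum fun k hk => (hf k hk).hasFDerivAt).fderiv]
  simp

theorem pd_smul {c : EuclideanSpace ℝ (Fin n) → ℝ} {f : EuclideanSpace ℝ (Fin n) → F}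
    (hc : DifferentiableAt ℝ c u) (hf : DifferentiableAt ℝ f u) (i : Fin n) :
    pd i (fun v => c v • f v) u = pd i c u • f u + c u • pd i f u := by
  simp only [pd]
  rw [(hc.hasFDerivAt.fun_smul hf.hasFDerivAt).fderiv]
  simp [add_comm]

theorem pd_mul {f g : EuclideanSpace ℝ (Fin n) → ℝ} (hf : DifferentiableAt ℝ f u)
    (hg : DifferentiableAt ℝ g u) (i : Fin n) :
    pd i (fun v => f v * g v) u = pd i f u * g u + f u * pd i g u :=
  pd_smul hf hg i

theorem pd_apply {m : ℕ} {f : EuclideanSpace ℝ (Fin n) → (Fin m → ℝ)}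
    (hf : DifferentiableAt ℝ f u) (i : Fin n) (k : Fin m) :
    pd i f u k = pd i (fun v => f v k) u := by
  simp only [pd]
  rw [(hasFDerivAt_pi'.1 hf.hasFDerivAt k).fderiv]
  rfl

/-- The product rule behind every frame relation: each is obtained by differentiating a pairing,
often a constant one. -/
theorem pd_pseudoForm {s m : ℕ} {f g : EuclideanSpace ℝ (Fin n) → (Fin m → ℝ)}
    (hf : DifferentiableAt ℝ f u) (hg : DifferentiableAt ℝ g u) (i : Fin n) :
    pd i (fun v => pseudoForm s m (f v) (g v)) u =
      pseudoForm s m (pd i f u) (g u) + pseudoForm s m (f u) (pd i g u) := by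
  have hf' : ∀ k, DifferentiableAt ℝ (fun v => f v k) u := differentiableAt_pi.1 hf
  have hg' : ∀ k, DifferentiableAt ℝ (fun v => g v k) u := differentiableAt_pi.1 hg
  simp only [← pseudoInner_eq_form, pseudoInner]
  rw [pd_sum _ fun k _ => ((hf' k).fun_mul (hg' k)).const_mul _, ← Finset.sum_add_distrib]
  refine Finset.sum_congr rfl fun k _ => ?_
  rw [pd_mul (differentiableAt_const _) ((hf' k).fun_mul (hg' k)), pd_const, pd_mul (hf' k) (hg' k),
    pd_apply hf, pd_apply hg]
  ring

theorem contDiffOn_pseudoForm {s m : ℕ} {f g : EuclideanSpace ℝ (Fin n) → (Fin m → ℝ)}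
    (hf : ContDiffOn ℝ ∞ f U) (hg : ContDiffOn ℝ ∞ g U) :
    ContDiffOn ℝ ∞ (fun v => pseudoForm s m (f v) (g v)) U := by
  simp only [← pseudoInner_eq_form, pseudoInner]
  exact ContDiffOn.sum fun k _ => contDiffOn_const.mul
    ((contDiffOn_pi.1 hf k).mul (contDiffOn_pi.1 hg k))

/-- A map with vanishing partial derivatives has vanishing derivative. -/
theorem fderiv_eq_zero_of_pd_eq_zero {f : EuclideanSpace ℝ (Fin n) → F}
    (h : ∀ i, pd i f u = 0) : fderiv ℝ f u = 0 := by
  refine ContinuousLinearMap.coe_injective ?_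
  refine (EuclideanSpace.basisFun (Fin n) ℝ).toBasis.ext fun i => ?_
  simpa [pd] using h i

/-! ### Smooth matrix-valued maps -/

/-- A matrix-valued map is smooth on `U` if its entries are. -/
def MatSmoothOn (U : Set (EuclideanSpace ℝ (Fin n)))
    (T : EuclideanSpace ℝ (Fin n) → Matrix (Fin n) (Fin n) ℝ) : Prop :=
  ∀ i j, ContDiffOn ℝ ∞ (fun v => T v i j) U

/-- The entrywise partial derivative of a matrix-valued map. -/
def mpd (k : Fin n) (T : EuclideanSpace ℝ (Fin n) → Matrix (Fin n) (Fin n) ℝ)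
    (u : EuclideanSpace ℝ (Fin n)) : Matrix (Fin n) (Fin n) ℝ :=
  Matrix.of fun i j => pd k (fun v => T v i j) u

variable {S T : EuclideanSpace ℝ (Fin n) → Matrix (Fin n) (Fin n) ℝ}

theorem MatSmoothOn.const (M : Matrix (Fin n) (Fin n) ℝ) : MatSmoothOn U fun _ => M :=
  fun _ _ => contDiffOn_const

theorem MatSmoothOn.mul (hS : MatSmoothOn U S) (hT : MatSmoothOn U T) :
    MatSmoothOn U fun v => S v * T v := fun i j => by
  simp only [Matrix.mul_apply]
  exact ContDiffOn.sum fun k _ => (hS i k).mul (hT k j)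

theorem MatSmoothOn.sub (hS : MatSmoothOn U S) (hT : MatSmoothOn U T) :
    MatSmoothOn U fun v => S v - T v := fun i j => (hS i j).sub (hT i j)

theorem MatSmoothOn.mono {V : Set (EuclideanSpace ℝ (Fin n))} (hT : MatSmoothOn U T)
    (h : V ⊆ U) : MatSmoothOn V T := fun i j => (hT i j).mono h

theorem contDiffOn_trace (hT : MatSmoothOn U T) : ContDiffOn ℝ ∞ (fun v => (T v).trace) U := by
  simp only [Matrix.trace, Matrix.diag]
  exact ContDiffOn.sum fun k _ => hT k k

theorem contDiffOn_det (hT : MatSmoothOn U T) : ContDiffOn ℝ ∞ (fun v => (T v).det) U := by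
  simp only [Matrix.det_apply, Units.smul_def, zsmul_eq_mul]
  exact ContDiffOn.sum fun σ _ => contDiffOn_const.mul (contDiffOn_prod fun i _ => hT _ _)

theorem MatSmoothOn.inv (hT : MatSmoothOn U T) (h : ∀ v ∈ U, (T v).det ≠ 0) :
    MatSmoothOn U fun v => (T v)⁻¹ := fun i j => by
  -- Cramer's rule: an entry of the adjugate is the determinant of the matrix with one row made
  -- constant.
  simp only [Matrix.inv_def, Matrix.smul_apply, Ring.inverse_eq_inv', smul_eq_mul,
    Matrix.adjugate_apply]
  refine ((contDiffOn_det hT).inv h).mul (contDiffOn_det fun k l => ?_)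
  by_cases hk : k = j
  · subst hk
    simpa using contDiffOn_const
  · simpa [Matrix.updateRow_ne hk] using hT k l

theorem mpd_congr (hU : IsOpen U) (h : Set.EqOn S T U) (hu : u ∈ U) (k : Fin n) :
    mpd k S u = mpd k T u := by
  ext i j
  exact pd_congr_of_eqOn hU (fun v hv => by rw [h hv]) hu k

theorem mpd_const (M : Matrix (Fin n) (Fin n) ℝ) (k : Fin n) : mpd k (fun _ => M) u = 0 := by
  ext i j
  exact pd_const _ _

theorem mpd_mul (hU : IsOpen U) (hS : MatSmoothOn U S) (hT : MatSmoothOn U T) (hu : u ∈ U)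
    (k : Fin n) : mpd k (fun v => S v * T v) u = mpd k S u * T u + S u * mpd k T u := by
  ext i j
  have hS' := fun i j => differentiableAt_of_contDiffOn hU (hS i j) hu
  have hT' := fun i j => differentiableAt_of_contDiffOn hU (hT i j) hu
  simp only [mpd, Matrix.of_apply, Matrix.mul_apply, Matrix.add_apply]
  rw [pd_sum _ fun l _ => (hS' i l).fun_mul (hT' l j), ← Finset.sum_add_distrib]
  exact Finset.sum_congr rfl fun l _ => pd_mul (hS' i l) (hT' l j) k

theorem mpd_sub (hU : IsOpen U) (hS : MatSmoothOn U S) (hT : MatSmoothOn U T) (hu : u ∈ U)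
    (k : Fin n) : mpd k (fun v => S v - T v) u = mpd k S u - mpd k T u := by
  ext i j
  exact pd_sub (differentiableAt_of_contDiffOn hU (hS i j) hu)
    (differentiableAt_of_contDiffOn hU (hT i j) hu) k

theorem mpd_smul_const (hU : IsOpen U) {c : EuclideanSpace ℝ (Fin n) → ℝ}
    (hc : ContDiffOn ℝ ∞ c U) (M : Matrix (Fin n) (Fin n) ℝ) (hu : u ∈ U) (k : Fin n) :
    mpd k (fun v => c v • M) u = pd k c u • M := by
  ext i j
  simp only [mpd, Matrix.of_apply, Matrix.smul_apply, smul_eq_mul]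
  rw [pd_mul (differentiableAt_of_contDiffOn hU hc hu) (differentiableAt_const _), pd_const]
  simp

theorem mpd_comm (hU : IsOpen U) (hT : MatSmoothOn U T) (hu : u ∈ U) (i j : Fin n) :
    mpd i (mpd j T) u = mpd j (mpd i T) u := by
  ext k l
  exact pd_comm hU (hT k l) hu i j

theorem pd_trace (hU : IsOpen U) (hT : MatSmoothOn U T) (hu : u ∈ U) (k : Fin n) :
    pd k (fun v => (T v).trace) u = (mpd k T u).trace := by
  simp only [Matrix.trace, Matrix.diag]
  exact pd_sum _ (fun l _ => differentiableAt_of_contDiffOn hU (hT l l) hu) k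

end Calculus

/-! ### Self-adjoint matrices with respect to a positive definite form -/

section MatrixAlgebra

open Matrix
open scoped MatrixOrder Matrix.Norms.L2Operator

variable {n : ℕ} {g a b T : Matrix (Fin n) (Fin n) ℝ}

/-- `T` is self-adjoint with respect to the bilinear form `g`. -/
def IsSelfAdj (g T : Matrix (Fin n) (Fin n) ℝ) : Prop := (g * T)ᵀ = g * T

/-- A self-adjoint matrix is conjugate to a symmetric one. -/
theorem IsSelfAdj.exists_conj (hg : g.PosDef) (hT : IsSelfAdj g T) :
    ∃ S R : Matrix (Fin n) (Fin n) ℝ, S * R = 1 ∧ R * S = 1 ∧ (S * T * R).IsHermitian := by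
  -- Factor g = QᵀQ with Q invertible and R = Q⁻¹; then Q T R = Rᵀ(gT)R is symmetric because gT is.
  obtain ⟨S, hS, hgS⟩ := CStarAlgebra.isStrictlyPositive_iff_eq_star_mul_self.1
      hg.isStrictlyPositive
  obtain ⟨S, rfl⟩ := hS
  simp only [Matrix.star_eq_conjTranspose, Matrix.conjTranspose_eq_transpose_of_trivial] at hgS
  obtain ⟨Q, R, hQR, hRQ'⟩ := S
  simp only at hgS
  refine ⟨Q, R, hQR, hRQ', ?_⟩
  have hRQ : Rᵀ * Qᵀ = 1 := by rw [← Matrix.transpose_mul, hQR, Matrix.transpose_one]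
  have e : Q * T * R = Rᵀ * (g * T) * R := by
    rw [hgS, ← Matrix.mul_assoc, ← Matrix.mul_assoc, hRQ, Matrix.one_mul]
  rw [Matrix.IsHermitian, Matrix.conjTranspose_eq_transpose_of_trivial, e, Matrix.transpose_mul,
    Matrix.transpose_mul, hT, Matrix.transpose_transpose]
  simp only [Matrix.mul_assoc]

/-- After conjugation to a symmetric matrix, the trace of the square is the sum of the squares of
the entries. -/
theorem IsSelfAdj.eq_zero_of_trace_mul_self (hg : g.PosDef) (hT : IsSelfAdj g T)
    (h : (T * T).trace = 0) : T = 0 := by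
  obtain ⟨S, R, hSR, hRS, hH⟩ := hT.exists_conj hg
  have h1 : ((S * T * R) * (S * T * R)ᴴ).trace = 0 := by
    rw [hH.eq, show S * T * R * (S * T * R) = S * (T * (R * S) * T * R) by
      simp only [Matrix.mul_assoc], hRS, Matrix.trace_mul_comm, Matrix.mul_one,
      Matrix.mul_assoc, hRS, Matrix.mul_one, h]
  have h2 := Matrix.trace_mul_conjTranspose_self_eq_zero_iff.1 h1
  calc T = (R * S) * T * (R * S) := by rw [hRS]; simp
    _ = R * (S * T * R) * S := by simp only [Matrix.mul_assoc]
    _ = 0 := by rw [h2]; simp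

/-- The cubic polynomial `(a - l₁)(a - l₂)(a - l₃)` of a matrix. -/
def cubic (l₁ l₂ l₃ : ℝ) (a : Matrix (Fin n) (Fin n) ℝ) : Matrix (Fin n) (Fin n) ℝ :=
  (a - l₁ • (1 : Matrix (Fin n) (Fin n) ℝ)) * (a - l₂ • (1 : Matrix (Fin n) (Fin n) ℝ))
      * (a - l₃ • (1 : Matrix (Fin n) (Fin n) ℝ))

theorem sub_smul_one_commute (a : Matrix (Fin n) (Fin n) ℝ) (l m : ℝ) :
    (a - l • (1 : Matrix (Fin n) (Fin n) ℝ)) * (a - m • (1 : Matrix (Fin n) (Fin n) ℝ))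
      = (a - m • (1 : Matrix (Fin n) (Fin n) ℝ)) * (a - l • (1 : Matrix (Fin n) (Fin n) ℝ)) := by
  simp only [sub_mul, mul_sub, smul_mul_assoc, mul_smul_comm, mul_one, one_mul]
  module

theorem sub_smul_one_mulVec (a : Matrix (Fin n) (Fin n) ℝ) (l : ℝ) (v : Fin n → ℝ) :
    (a - l • (1 : Matrix (Fin n) (Fin n) ℝ)) *ᵥ v = a *ᵥ v - l • v := by
  rw [Matrix.sub_mulVec, Matrix.smul_mulVec, Matrix.one_mulVec]

theorem hasEigenvalue_toLin'_iff {l : ℝ} :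
    Module.End.HasEigenvalue (Matrix.toLin' a) l ↔ ∃ v, v ≠ 0 ∧ a *ᵥ v = l • v := by
  constructor
  · intro h
    obtain ⟨v, hv⟩ := h.exists_hasEigenvector
    exact ⟨v, hv.2, by simpa using hv.apply_eq_smul⟩
  · rintro ⟨v, hv, h⟩
    exact Module.End.hasEigenvalue_of_hasEigenvector
      (Module.End.hasEigenvector_iff.2 ⟨Module.End.mem_eigenspace_iff.2 (by simpa using h), hv⟩)

/-- A self-adjoint matrix whose eigenvalues are among `l₁, l₂, l₃` is annihilated by
`(x - l₁)(x - l₂)(x - l₃)`. -/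
theorem IsSelfAdj.cubic_eq_zero (hg : g.PosDef) (ha : IsSelfAdj g a) {l₁ l₂ l₃ : ℝ}
    (h : ∀ l v, v ≠ 0 → a *ᵥ v = l • v → l = l₁ ∨ l = l₂ ∨ l = l₃) : cubic l₁ l₂ l₃ a = 0 := by
  obtain ⟨S, R, hSR, hRS, hH⟩ := ha.exists_conj hg
  have hann : ∀ (v : Fin n → ℝ) (l : ℝ), a *ᵥ v = l • v → cubic l₁ l₂ l₃ a *ᵥ v = 0 := by
    intro v l hv
    by_cases h0 : v = 0
    · simp [h0]
    rw [cubic, ← Matrix.mulVec_mulVec, ← Matrix.mulVec_mulVec]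
    simp only [Matrix.mulVec_smul, sub_smul_one_mulVec, hv, ← sub_smul]
    rcases h l v h0 hv with rfl | rfl | rfl <;> simp
  -- `R` carries the orthonormal eigenbasis of the symmetric conjugate to a basis of eigenvectors of
  -- `a`.
  have key : ∀ j, cubic l₁ l₂ l₃ a *ᵥ (R *ᵥ (hH.eigenvectorBasis j).ofLp) = 0 := by
    intro j
    refine hann _ (hH.eigenvalues j) ?_
    have := hH.mulVec_eigenvectorBasis j
    rw [← Matrix.mulVec_smul, ← this, Matrix.mulVec_mulVec, Matrix.mulVec_mulVec,
      ← Matrix.mul_assoc, ← Matrix.mul_assoc, hRS, Matrix.one_mul]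
  have h0 : cubic l₁ l₂ l₃ a * R = 0 := by
    refine Matrix.toLin'.injective
      ((hH.eigenvectorBasis.toBasis.map (WithLp.linearEquiv 2 ℝ (Fin n → ℝ))).ext fun j => ?_)
    simpa [← Matrix.mulVec_mulVec] using key j
  calc cubic l₁ l₂ l₃ a = cubic l₁ l₂ l₃ a * R * S := by rw [Matrix.mul_assoc, hRS, Matrix.mul_one]
    _ = 0 := by rw [h0, Matrix.zero_mul]

/-- If `a` is annihilated by a cubic with distinct roots, a matrix killing all eigenvectors of `a`
vanishes. -/
theorem eq_zero_of_eigenvectors {l₁ l₂ l₃ : ℝ} (h12 : l₁ ≠ l₂) (h13 : l₁ ≠ l₃) (h23 : l₂ ≠ l₃)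
    (ha : cubic l₁ l₂ l₃ a = 0)
    (h₁ : ∀ v, a *ᵥ v = l₁ • v → T *ᵥ v = 0) (h₂ : ∀ v, a *ᵥ v = l₂ • v → T *ᵥ v = 0)
    (h₃ : ∀ v, a *ᵥ v = l₃ • v → T *ᵥ v = 0) : T = 0 := by
  -- The columns of `Q` are eigenvectors of `a` for `l`, so `T` kills them.
  have aux : ∀ (l : ℝ) (Q : Matrix (Fin n) (Fin n) ℝ),
      (a - l • (1 : Matrix (Fin n) (Fin n) ℝ)) * Q = 0 →
      (∀ v, a *ᵥ v = l • v → T *ᵥ v = 0) → T * Q = 0 := by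
    intro l Q hQ hT
    refine Matrix.ext_of_mulVec_single fun j => ?_
    rw [← Matrix.mulVec_mulVec, Matrix.zero_mulVec]
    refine hT _ (sub_eq_zero.1 ?_)
    rw [← sub_smul_one_mulVec, Matrix.mulVec_mulVec, hQ, Matrix.zero_mulVec]
  have e₁ := aux l₁ ((a - l₂ • (1 : Matrix (Fin n) (Fin n) ℝ))
      * (a - l₃ • (1 : Matrix (Fin n) (Fin n) ℝ)))
    (by rw [← Matrix.mul_assoc]; exact ha) h₁
  have e₂ := aux l₂ ((a - l₁ • (1 : Matrix (Fin n) (Fin n) ℝ))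
      * (a - l₃ • (1 : Matrix (Fin n) (Fin n) ℝ)))
    (by rw [← Matrix.mul_assoc, sub_smul_one_commute]; exact ha) h₂
  have e₃ := aux l₃ ((a - l₁ • (1 : Matrix (Fin n) (Fin n) ℝ))
      * (a - l₂ • (1 : Matrix (Fin n) (Fin n) ℝ)))
    (by rw [← Matrix.mul_assoc, sub_smul_one_commute, Matrix.mul_assoc,
          sub_smul_one_commute a l₃ l₂, ← Matrix.mul_assoc]; exact ha) h₃
  -- Lagrange interpolation of the constant 1 at the three roots, with denominators cleared.
  have hI : ((l₁ - l₂) * (l₁ - l₃) * (l₂ - l₃)) • (1 : Matrix (Fin n) (Fin n) ℝ) =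
      (l₂ - l₃) • ((a - l₂ • (1 : Matrix (Fin n) (Fin n) ℝ))
          * (a - l₃ • (1 : Matrix (Fin n) (Fin n) ℝ)))
      - (l₁ - l₃) • ((a - l₁ • (1 : Matrix (Fin n) (Fin n) ℝ))
          * (a - l₃ • (1 : Matrix (Fin n) (Fin n) ℝ)))
      + (l₁ - l₂) • ((a - l₁ • (1 : Matrix (Fin n) (Fin n) ℝ))
          * (a - l₂ • (1 : Matrix (Fin n) (Fin n) ℝ))) := by
    simp only [sub_mul, mul_sub, smul_mul_assoc, mul_smul_comm, mul_one, one_mul]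
    module
  have h0 : ((l₁ - l₂) * (l₁ - l₃) * (l₂ - l₃)) • T = 0 := by
    calc _ = T * (((l₁ - l₂) * (l₁ - l₃) * (l₂ - l₃)) • (1 : Matrix (Fin n) (Fin n) ℝ)) := by
          rw [mul_smul_comm, Matrix.mul_one]
      _ = 0 := by
          rw [hI, Matrix.mul_add, Matrix.mul_sub, mul_smul_comm, mul_smul_comm, mul_smul_comm,
            e₁, e₂, e₃]
          simp
  refine (smul_eq_zero.1 h0).resolve_left ?_
  simp [sub_eq_zero, h12, h13, h23]

/-! ### Algebraic consequences of the Gauss equation -/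

/-- The value on `Z` of the curvature operator in the plane of `X` and `Y`, as given by the Gauss
equation for the Blaschke tensor `g a` and the second fundamental form `g b`. -/
def gaussCurvature (g a b : Matrix (Fin n) (Fin n) ℝ) (X Y Z : Fin n → ℝ) : Fin n → ℝ :=
  (Z ⬝ᵥ g *ᵥ (a *ᵥ Y)) • X + (Z ⬝ᵥ g *ᵥ Y) • (a *ᵥ X) - (Z ⬝ᵥ g *ᵥ (b *ᵥ Y)) • (b *ᵥ X)
    - ((Z ⬝ᵥ g *ᵥ (a *ᵥ X)) • Y + (Z ⬝ᵥ g *ᵥ X) • (a *ᵥ Y) - (Z ⬝ᵥ g *ᵥ (b *ᵥ X)) • (b *ᵥ Y))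

theorem dotProduct_mulVec_symm {A : Matrix (Fin n) (Fin n) ℝ} (hA : Aᵀ = A) (v w : Fin n → ℝ) :
    v ⬝ᵥ A *ᵥ w = w ⬝ᵥ A *ᵥ v := by
  rw [Matrix.dotProduct_mulVec, ← Matrix.mulVec_transpose, hA, dotProduct_comm]

theorem IsSelfAdj.dotProduct_eq_zero (hg : gᵀ = g) (ha : IsSelfAdj g a) {l m : ℝ} (hlm : l ≠ m)
    {v w : Fin n → ℝ} (hv : a *ᵥ v = l • v) (hw : a *ᵥ w = m • w) : v ⬝ᵥ g *ᵥ w = 0 := by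
  have h1 := dotProduct_mulVec_symm ha v w
  rw [← Matrix.mulVec_mulVec, ← Matrix.mulVec_mulVec, hv, hw, Matrix.mulVec_smul,
    Matrix.mulVec_smul, dotProduct_smul, dotProduct_smul, dotProduct_mulVec_symm hg w v,
    smul_eq_mul, smul_eq_mul] at h1
  have h2 : (l - m) * (v ⬝ᵥ g *ᵥ w) = 0 := by linear_combination -h1
  exact (mul_eq_zero.1 h2).resolve_left (sub_ne_zero.2 hlm)

/-- If the Gauss curvature commutes with `a`, the mixed sectional curvatures of two eigenspaces of
`a` vanish. -/
theorem mixed_curvature (hg : gᵀ = g) (ha : IsSelfAdj g a) (hab : a * b = b * a)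
    (hR : ∀ X Y Z, a *ᵥ gaussCurvature g a b X Y Z = gaussCurvature g a b X Y (a *ᵥ Z))
    {l m : ℝ} (hlm : l ≠ m) {X Y Z : Fin n → ℝ} (hX : a *ᵥ X = l • X) (hY : a *ᵥ Y = m • Y)
    (hZ : a *ᵥ Z = m • Z) :
    (Z ⬝ᵥ g *ᵥ (b *ᵥ Y)) • (b *ᵥ X) = ((l + m) * (Z ⬝ᵥ g *ᵥ Y)) • X := by
  -- As `b` preserves the eigenspaces of `a`, both `X` and `b X` are orthogonal to `Z`, which
  -- removes half of the Gauss terms.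
  have hbX : a *ᵥ (b *ᵥ X) = l • (b *ᵥ X) := by
    rw [Matrix.mulVec_mulVec, hab, ← Matrix.mulVec_mulVec, hX, Matrix.mulVec_smul]
  have h0 : Z ⬝ᵥ g *ᵥ X = 0 := ha.dotProduct_eq_zero hg hlm.symm hZ hX
  have h1 : Z ⬝ᵥ g *ᵥ (b *ᵥ X) = 0 := ha.dotProduct_eq_zero hg hlm.symm hZ hbX
  -- The scalar `c` lets one formula serve both `Z` and `a Z = m Z`. The result lies in the
  -- `l`-eigenspace, so `hR` equates its multiples by `l` and by `m`.
  have hW : ∀ c : ℝ, gaussCurvature g a b X Y (c • Z) =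
      c • (((l + m) * (Z ⬝ᵥ g *ᵥ Y)) • X - (Z ⬝ᵥ g *ᵥ (b *ᵥ Y)) • (b *ᵥ X)) := by
    intro c
    simp only [gaussCurvature, hX, hY, Matrix.mulVec_smul, smul_dotProduct, dotProduct_smul, h0,
      h1, smul_eq_mul, mul_zero]
    module
  have h2 := hR X Y Z
  rw [hZ, hW m, ← one_smul ℝ Z, hW 1, one_smul, one_smul, Matrix.mulVec_sub, Matrix.mulVec_smul,
    Matrix.mulVec_smul, hX, hbX] at h2
  have h3 : (l - m) • (((l + m) * (Z ⬝ᵥ g *ᵥ Y)) • X - (Z ⬝ᵥ g *ᵥ (b *ᵥ Y)) • (b *ᵥ X)) = 0 := by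
    rw [sub_smul, ← h2]
    module
  exact (sub_eq_zero.1 ((smul_eq_zero.1 h3).resolve_left (sub_ne_zero.2 hlm))).symm

/-- With three distinct eigenvalues, the vanishing of the mixed sectional curvatures determines
`b` in terms of `a`, up to sign. -/
theorem exists_mul_eq_smul_one (hg : g.PosDef) (ha : IsSelfAdj g a) (hab : a * b = b * a)
    (hR : ∀ X Y Z, a *ᵥ gaussCurvature g a b X Y Z = gaussCurvature g a b X Y (a *ᵥ Z))
    {l₁ l₂ l₃ : ℝ} (h12 : l₁ ≠ l₂) (h13 : l₁ ≠ l₃) (h23 : l₂ ≠ l₃)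
    (h₁ : ∃ v, v ≠ 0 ∧ a *ᵥ v = l₁ • v) (h₂ : ∃ v, v ≠ 0 ∧ a *ᵥ v = l₂ • v)
    (h₃ : ∃ v, v ≠ 0 ∧ a *ᵥ v = l₃ • v) (hq : cubic l₁ l₂ l₃ a = 0) :
    ∃ p : ℝ, p ≠ 0 ∧ p ^ 2 = (l₁ + l₂) * (l₁ + l₃) * (l₂ + l₃) ∧
      b * ((l₁ + l₂ + l₃) • (1 : Matrix (Fin n) (Fin n) ℝ) - a) =
          p • (1 : Matrix (Fin n) (Fin n) ℝ) := by
  have hgs : gᵀ = g := by simpa using hg.isHermitian.eq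
  obtain ⟨x₁, hx₁, e₁⟩ := h₁
  obtain ⟨x₂, hx₂, e₂⟩ := h₂
  obtain ⟨x₃, hx₃, e₃⟩ := h₃
  have hpos : ∀ x : Fin n → ℝ, x ≠ 0 → x ⬝ᵥ g *ᵥ x ≠ 0 := fun x hx => by
    have := hg.dotProduct_mulVec_pos hx
    simp only [star_trivial] at this
    exact this.ne'
  -- A Rayleigh quotient, available before it is known that `b` is scalar on each eigenspace.
  set β : (Fin n → ℝ) → ℝ := fun x => (x ⬝ᵥ g *ᵥ (b *ᵥ x)) / (x ⬝ᵥ g *ᵥ x) with hβ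
  have hmix : ∀ {l m : ℝ} {X Y : Fin n → ℝ}, l ≠ m → a *ᵥ X = l • X → a *ᵥ Y = m • Y → Y ≠ 0 →
      β Y • (b *ᵥ X) = (l + m) • X := by
    intro l m X Y hlm hX hY hY0
    have := mixed_curvature hgs ha hab hR hlm hX hY hY
    rw [show β Y = (Y ⬝ᵥ g *ᵥ (b *ᵥ Y)) / (Y ⬝ᵥ g *ᵥ Y) from rfl, div_eq_inv_mul, mul_smul, this,
      smul_smul]
    congr 1
    field_simp [hpos Y hY0]
  have hββ : ∀ {l m : ℝ} {X Y : Fin n → ℝ}, l ≠ m → a *ᵥ X = l • X → a *ᵥ Y = m • Y → X ≠ 0 →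
      Y ≠ 0 → β Y * β X = l + m := by
    intro l m X Y hlm hX hY hX0 hY0
    have := congrArg (fun w => X ⬝ᵥ g *ᵥ w) (hmix hlm hX hY hY0)
    simp only [Matrix.mulVec_smul, dotProduct_smul, smul_eq_mul] at this
    rw [show β X = (X ⬝ᵥ g *ᵥ (b *ᵥ X)) / (X ⬝ᵥ g *ᵥ X) from rfl, mul_div_assoc', this,
      mul_div_assoc, div_self (hpos X hX0), mul_one]
  have b21 := hββ h12 e₁ e₂ hx₁ hx₂
  have b31 := hββ h13 e₁ e₃ hx₁ hx₃
  have b32 := hββ h23 e₂ e₃ hx₂ hx₃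
  -- If one β vanished, both sums involving its eigenvalue would be zero, and the other two
  -- eigenvalues would coincide.
  have n1 : β x₁ ≠ 0 := fun h => h23 (by rw [h] at b21 b31; linarith)
  have n2 : β x₂ ≠ 0 := fun h => h13 (by rw [h] at b21 b32; linarith)
  have n3 : β x₃ ≠ 0 := fun h => h12 (by rw [h] at b31 b32; linarith)
  refine ⟨β x₁ * β x₂ * β x₃, by positivity, ?_, ?_⟩
  · rw [← b21, ← b31, ← b32]; ring
  -- Cancelling `β Y` for a vector `Y` of another eigenspace shows that `b` acts on the whole
  -- `l`-eigenspace as the scalar `β x`.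
  have hb : ∀ {l m : ℝ} {x : Fin n → ℝ} {X Y : Fin n → ℝ}, l ≠ m → a *ᵥ X = l • X →
      a *ᵥ x = l • x → x ≠ 0 → a *ᵥ Y = m • Y → Y ≠ 0 → β Y ≠ 0 → b *ᵥ X = β x • X := by
    intro l m x X Y hlm hX hx hx0 hY hY0 hn
    have := hmix hlm hX hY hY0
    rw [← hββ hlm hx hY hx0 hY0, mul_smul] at this
    exact smul_right_injective _ hn this
  have hM : ∀ {l c : ℝ} {X : Fin n → ℝ}, a *ᵥ X = l • X → b *ᵥ X = c • X →
      (b * ((l₁ + l₂ + l₃) • (1 : Matrix (Fin n) (Fin n) ℝ) - a)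
        - (β x₁ * β x₂ * β x₃) • (1 : Matrix (Fin n) (Fin n) ℝ)) *ᵥ X =
        (c * (l₁ + l₂ + l₃ - l) - β x₁ * β x₂ * β x₃) • X := by
    intro l c X hX hbX
    rw [Matrix.sub_mulVec, ← Matrix.mulVec_mulVec, Matrix.sub_mulVec, Matrix.smul_mulVec,
      Matrix.smul_mulVec, Matrix.one_mulVec, hX, ← sub_smul, Matrix.mulVec_smul, hbX]
    module
  refine sub_eq_zero.1 (eq_zero_of_eigenvectors h12 h13 h23 hq (fun v hv => ?_) (fun v hv => ?_)
    fun v hv => ?_)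
  · rw [hM hv (hb h12 hv e₁ hx₁ e₂ hx₂ n2), show l₁ + l₂ + l₃ - l₁ = l₂ + l₃ by ring, ← b32]
    rw [show β x₁ * (β x₃ * β x₂) - β x₁ * β x₂ * β x₃ = 0 by ring, zero_smul]
  · rw [hM hv (hb h12.symm hv e₂ hx₂ e₁ hx₁ n1), show l₁ + l₂ + l₃ - l₂ = l₁ + l₃ by ring, ← b31]
    rw [show β x₂ * (β x₃ * β x₁) - β x₁ * β x₂ * β x₃ = 0 by ring, zero_smul]
  · rw [hM hv (hb h13.symm hv e₃ hx₃ e₁ hx₁ n1), show l₁ + l₂ + l₃ - l₃ = l₁ + l₂ by ring, ← b21]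
    rw [show β x₃ * (β x₂ * β x₁) - β x₁ * β x₂ * β x₃ = 0 by ring, zero_smul]

end MatrixAlgebra

/-! ### The moving frame of a canonical lift -/

section Frame

open Matrix

variable {n : ℕ}

/-- The bilinear form of `ℝ^{n+3}_2`. -/
local notation "⟪" v ", " w "⟫" => pseudoForm 2 _ v w

/-- A smooth spacelike map `Y` into the light cone, with a conformal normal field `ξ`. -/
structure ConformalFrame (U : Set (EuclideanSpace ℝ (Fin n)))
    (Y ξ : EuclideanSpace ℝ (Fin n) → (Fin (n + 1 + 2) → ℝ)) : Prop where
  isOpen : IsOpen U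
  dim_ne : n ≠ 0
  smooth : ContDiffOn ℝ ∞ Y U
  null : ∀ u ∈ U, ⟪Y u, Y u⟫ = 0
  posDef : ∀ u ∈ U, (inducedMetric Y u).PosDef
  smoothNormal : ContDiffOn ℝ ∞ ξ U
  normal_normal : ∀ u ∈ U, ⟪ξ u, ξ u⟫ = -1
  normal_lift : ∀ u ∈ U, ⟪ξ u, Y u⟫ = 0
  normal_conformalN : ∀ u ∈ U, ⟪ξ u, conformalN Y u⟫ = 0
  normal_pd : ∀ u ∈ U, ∀ i, ⟪ξ u, pd i Y u⟫ = 0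

/-- The matrix of the Levi-Civita connection form in the direction `i`. -/
def connection (g : EuclideanSpace ℝ (Fin n) → Matrix (Fin n) (Fin n) ℝ) (i : Fin n)
    (u : EuclideanSpace ℝ (Fin n)) : Matrix (Fin n) (Fin n) ℝ :=
  Matrix.of fun k j => christoffel g k i j u

/-- The matrix of the curvature operator in the coordinate plane of `i` and `j`. -/
def curvature (g : EuclideanSpace ℝ (Fin n) → Matrix (Fin n) (Fin n) ℝ) (i j : Fin n)
    (u : EuclideanSpace ℝ (Fin n)) : Matrix (Fin n) (Fin n) ℝ :=
  mpd i (connection g j) u - mpd j (connection g i) u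
    + (connection g i u * connection g j u - connection g j u * connection g i u)

/-- The Weingarten-type matrix `g⁻¹ T` of a covariant 2-tensor `T`. -/
def raise (g T : EuclideanSpace ℝ (Fin n) → Matrix (Fin n) (Fin n) ℝ)
    (u : EuclideanSpace ℝ (Fin n)) : Matrix (Fin n) (Fin n) ℝ :=
  (g u)⁻¹ * T u

/-- The component `⟨∂ᵢ N, ξ⟩` of the conformal form. -/
def conformalForm (Y ξ : EuclideanSpace ℝ (Fin n) → (Fin (n + 1 + 2) → ℝ)) (i : Fin n)
    (u : EuclideanSpace ℝ (Fin n)) : ℝ :=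
  ⟪pd i (conformalN Y) u, ξ u⟫

theorem inducedMetric_apply (Y : EuclideanSpace ℝ (Fin n) → (Fin (n + 1 + 2) → ℝ))
    (u : EuclideanSpace ℝ (Fin n)) (i j : Fin n) :
    inducedMetric Y u i j = ⟪pd i Y u, pd j Y u⟫ := rfl

theorem blaschkeTensor_apply (Y : EuclideanSpace ℝ (Fin n) → (Fin (n + 1 + 2) → ℝ))
    (u : EuclideanSpace ℝ (Fin n)) (i j : Fin n) :
    blaschkeTensor Y u i j = ⟪pd i (conformalN Y) u, pd j Y u⟫ := rfl

theorem secondForm_apply (Y ξ : EuclideanSpace ℝ (Fin n) → (Fin (n + 1 + 2) → ℝ))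
    (u : EuclideanSpace ℝ (Fin n)) (i j : Fin n) :
    secondForm Y ξ u i j = ⟪pd i ξ u, pd j Y u⟫ := rfl

theorem inducedMetric_symm (Y : EuclideanSpace ℝ (Fin n) → (Fin (n + 1 + 2) → ℝ))
    (u : EuclideanSpace ℝ (Fin n)) (i j : Fin n) :
    inducedMetric Y u i j = inducedMetric Y u j i := pseudoForm_comm _ _ _ _

theorem inducedMetric_transpose (Y : EuclideanSpace ℝ (Fin n) → (Fin (n + 1 + 2) → ℝ))
    (u : EuclideanSpace ℝ (Fin n)) : (inducedMetric Y u)ᵀ = inducedMetric Y u := by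
  ext i j; exact inducedMetric_symm Y u j i

namespace ConformalFrame

variable {U : Set (EuclideanSpace ℝ (Fin n))} {u : EuclideanSpace ℝ (Fin n)}
  {Y ξ : EuclideanSpace ℝ (Fin n) → (Fin (n + 1 + 2) → ℝ)}

theorem diff (h : ConformalFrame U Y ξ) (hu : u ∈ U) : DifferentiableAt ℝ Y u :=
  differentiableAt_of_contDiffOn h.isOpen h.smooth hu

theorem smooth_pd (h : ConformalFrame U Y ξ) (i : Fin n) : ContDiffOn ℝ ∞ (pd i Y) U :=
  contDiffOn_pd h.isOpen h.smooth i

theorem diff_pd (h : ConformalFrame U Y ξ) (hu : u ∈ U) (i : Fin n) :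
    DifferentiableAt ℝ (pd i Y) u :=
  differentiableAt_of_contDiffOn h.isOpen (h.smooth_pd i) hu

theorem diffNormal (h : ConformalFrame U Y ξ) (hu : u ∈ U) : DifferentiableAt ℝ ξ u :=
  differentiableAt_of_contDiffOn h.isOpen h.smoothNormal hu

theorem smooth_metric (h : ConformalFrame U Y ξ) : MatSmoothOn U (inducedMetric Y) :=
  fun i j => contDiffOn_pseudoForm (h.smooth_pd i) (h.smooth_pd j)

theorem det_ne (h : ConformalFrame U Y ξ) (hu : u ∈ U) : (inducedMetric Y u).det ≠ 0 :=
  (h.posDef u hu).det_pos.ne'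

theorem inv_mul (h : ConformalFrame U Y ξ) (hu : u ∈ U) :
    (inducedMetric Y u)⁻¹ * inducedMetric Y u = 1 :=
  Matrix.nonsing_inv_mul _ (h.det_ne hu).isUnit

theorem mul_inv (h : ConformalFrame U Y ξ) (hu : u ∈ U) :
    inducedMetric Y u * (inducedMetric Y u)⁻¹ = 1 :=
  Matrix.mul_nonsing_inv _ (h.det_ne hu).isUnit

theorem inv_symm (i j : Fin n) : (inducedMetric Y u)⁻¹ i j = (inducedMetric Y u)⁻¹ j i := by
  conv_lhs => rw [← inducedMetric_transpose Y u, ← Matrix.transpose_nonsing_inv]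
  rfl

theorem smooth_inv (h : ConformalFrame U Y ξ) : MatSmoothOn U fun v => (inducedMetric Y v)⁻¹ :=
  h.smooth_metric.inv fun _ hv => h.det_ne hv

theorem smooth_connection (h : ConformalFrame U Y ξ) (i : Fin n) :
    MatSmoothOn U (connection (inducedMetric Y) i) := fun k j =>
  contDiffOn_const.mul <| ContDiffOn.sum fun l _ => (h.smooth_inv k l).mul <|
    ((contDiffOn_pd h.isOpen (h.smooth_metric j l) i).add
      (contDiffOn_pd h.isOpen (h.smooth_metric i l) j)).sub
      (contDiffOn_pd h.isOpen (h.smooth_metric i j) l)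

theorem smooth_laplacian (h : ConformalFrame U Y ξ) :
    ContDiffOn ℝ ∞ (laplacian (inducedMetric Y) Y) U :=
  ContDiffOn.sum fun i _ => ContDiffOn.sum fun j _ => (h.smooth_inv i j).smul <|
    (contDiffOn_pd h.isOpen (h.smooth_pd j) i).sub <|
      ContDiffOn.sum fun k _ => (h.smooth_connection i k j).smul (h.smooth_pd k)

theorem smooth_conformalN (h : ConformalFrame U Y ξ) : ContDiffOn ℝ ∞ (conformalN Y) U :=
  have h1 : ContDiffOn ℝ ∞ (fun v => (-(1 / (n : ℝ))) • laplacian (inducedMetric Y) Y v) U :=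
    h.smooth_laplacian.const_smul _
  have h2 : ContDiffOn ℝ ∞ (fun v => ((1 / (2 * (n : ℝ) ^ 2)) *
      ⟪laplacian (inducedMetric Y) Y v, laplacian (inducedMetric Y) Y v⟫) • Y v) U :=
    (contDiffOn_const.mul (contDiffOn_pseudoForm h.smooth_laplacian h.smooth_laplacian)).smul
      h.smooth
  h1.sub h2

theorem diff_conformalN (h : ConformalFrame U Y ξ) (hu : u ∈ U) :
    DifferentiableAt ℝ (conformalN Y) u :=
  differentiableAt_of_contDiffOn h.isOpen h.smooth_conformalN hu

theorem smooth_blaschke (h : ConformalFrame U Y ξ) : MatSmoothOn U (blaschkeTensor Y) :=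
  fun i j => contDiffOn_pseudoForm (contDiffOn_pd h.isOpen h.smooth_conformalN i) (h.smooth_pd j)

theorem smooth_secondForm (h : ConformalFrame U Y ξ) : MatSmoothOn U (secondForm Y ξ) :=
  fun i j => contDiffOn_pseudoForm (contDiffOn_pd h.isOpen h.smoothNormal i) (h.smooth_pd j)

/-! ### Pairings of the frame and its derivatives -/

theorem pd_lift (h : ConformalFrame U Y ξ) (hu : u ∈ U) (i : Fin n) : ⟪pd i Y u, Y u⟫ = 0 := by
  have h1 := pd_pseudoForm (s := 2) (h.diff hu) (h.diff hu) i
  rw [pd_eq_zero_of_eqOn_const h.isOpen h.null hu, pseudoForm_comm _ _ (Y u)] at h1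
  linarith

theorem pd_pd_lift (h : ConformalFrame U Y ξ) (hu : u ∈ U) (i j : Fin n) :
    ⟪pd i (pd j Y) u, Y u⟫ = -inducedMetric Y u i j := by
  have h1 := pd_pseudoForm (s := 2) (h.diff_pd hu j) (h.diff hu) i
  rw [pd_eq_zero_of_eqOn_const h.isOpen (fun v hv => h.pd_lift hv j) hu,
    pseudoForm_comm _ _ (pd j Y u)] at h1
  rw [inducedMetric_apply]
  linarith

theorem pd_metric (h : ConformalFrame U Y ξ) (hu : u ∈ U) (i j k : Fin n) :
    pd k (fun v => inducedMetric Y v i j) u =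
      ⟪pd k (pd i Y) u, pd j Y u⟫ + ⟪pd k (pd j Y) u, pd i Y u⟫ := by
  rw [pseudoForm_comm _ _ (pd k (pd j Y) u)]
  exact pd_pseudoForm (h.diff_pd hu i) (h.diff_pd hu j) k

theorem pd_pd_comm (h : ConformalFrame U Y ξ) (hu : u ∈ U) (i j : Fin n) :
    pd i (pd j Y) u = pd j (pd i Y) u := pd_comm h.isOpen h.smooth hu i j

/-- For a metric induced from a flat form the Christoffel symbols are the tangential components of
∂ᵢ∂ⱼY: after the product rule four of the six terms cancel. -/
theorem christoffel_eq (h : ConformalFrame U Y ξ) (hu : u ∈ U) (k i j : Fin n) :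
    christoffel (inducedMetric Y) k i j u =
      ∑ l, (inducedMetric Y u)⁻¹ k l * ⟪pd i (pd j Y) u, pd l Y u⟫ := by
  rw [christoffel, Finset.mul_sum]
  refine Finset.sum_congr rfl fun l _ => ?_
  rw [h.pd_metric hu, h.pd_metric hu, h.pd_metric hu, h.pd_pd_comm hu l i, h.pd_pd_comm hu l j,
    h.pd_pd_comm hu j i]
  ring

theorem christoffel_symm (h : ConformalFrame U Y ξ) (hu : u ∈ U) (k i j : Fin n) :
    christoffel (inducedMetric Y) k i j u = christoffel (inducedMetric Y) k j i u := by
  rw [h.christoffel_eq hu, h.christoffel_eq hu, h.pd_pd_comm hu]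

theorem sum_christoffel_metric (h : ConformalFrame U Y ξ) (hu : u ∈ U) (i j l : Fin n) :
    ∑ k, christoffel (inducedMetric Y) k i j u * inducedMetric Y u k l =
      ⟪pd i (pd j Y) u, pd l Y u⟫ := by
  have h1 : (inducedMetric Y u) *ᵥ ((inducedMetric Y u)⁻¹ *ᵥ
      fun l => ⟪pd i (pd j Y) u, pd l Y u⟫) = fun l => ⟪pd i (pd j Y) u, pd l Y u⟫ := by
    rw [Matrix.mulVec_mulVec, h.mul_inv hu, Matrix.one_mulVec]
  rw [← congrFun h1 l]
  refine Finset.sum_congr rfl fun k _ => ?_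
  rw [h.christoffel_eq hu, inducedMetric_symm, mul_comm]
  rfl

theorem sum_inv_mul (T : Matrix (Fin n) (Fin n) ℝ) :
    ∑ i, ∑ j, (inducedMetric Y u)⁻¹ i j * T i j = ((inducedMetric Y u)⁻¹ * T).trace := by
  simp only [Matrix.trace, Matrix.diag, Matrix.mul_apply]
  rw [Finset.sum_comm]
  exact Finset.sum_congr rfl fun i _ => Finset.sum_congr rfl fun j _ => by rw [inv_symm]

/-- Pairing of the Laplacian with a vector orthogonal to the tangent space. -/
theorem form_laplacian (w : Fin (n + 1 + 2) → ℝ)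
    (hw : ∀ k, ⟪w, pd k Y u⟫ = 0) :
    ⟪w, laplacian (inducedMetric Y) Y u⟫ =
      ∑ i, ∑ j, (inducedMetric Y u)⁻¹ i j * ⟪w, pd i (pd j Y) u⟫ := by
  simp [laplacian, hw]

/-- The Christoffel correction removes exactly the tangential part of ∂ᵢ∂ⱼY. -/
theorem laplacian_pd (h : ConformalFrame U Y ξ) (hu : u ∈ U) (l : Fin n) :
    ⟪laplacian (inducedMetric Y) Y u, pd l Y u⟫ = 0 := by
  simp only [laplacian, map_sum, LinearMap.sum_apply, map_smul, LinearMap.smul_apply, map_sub,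
    LinearMap.sub_apply, smul_eq_mul]
  refine Finset.sum_eq_zero fun i _ => Finset.sum_eq_zero fun j _ => ?_
  rw [← h.sum_christoffel_metric hu i j l]
  simp [inducedMetric_apply]

theorem lift_laplacian (h : ConformalFrame U Y ξ) (hu : u ∈ U) :
    ⟪Y u, laplacian (inducedMetric Y) Y u⟫ = -(n : ℝ) := by
  rw [form_laplacian _ fun k => by rw [pseudoForm_comm, h.pd_lift hu]]
  simp only [pseudoForm_comm _ _ (Y u), h.pd_pd_lift hu, mul_neg, Finset.sum_neg_distrib]
  rw [sum_inv_mul, h.inv_mul hu]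
  simp

theorem conformalN_eq : conformalN Y u = (-(1 / (n : ℝ))) • laplacian (inducedMetric Y) Y u
    - ((1 / (2 * (n : ℝ) ^ 2)) * ⟪laplacian (inducedMetric Y) Y u,
        laplacian (inducedMetric Y) Y u⟫) • Y u := rfl

theorem dim_cast_ne (h : ConformalFrame U Y ξ) : (n : ℝ) ≠ 0 := Nat.cast_ne_zero.2 h.dim_ne

theorem conformalN_lift (h : ConformalFrame U Y ξ) (hu : u ∈ U) :
    ⟪conformalN Y u, Y u⟫ = 1 := by
  have := h.dim_cast_ne
  rw [conformalN_eq, map_sub, map_smul, map_smul, LinearMap.sub_apply, LinearMap.smul_apply,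
    LinearMap.smul_apply, h.null u hu, pseudoForm_comm, h.lift_laplacian hu, smul_eq_mul,
    smul_eq_mul]
  field_simp
  ring

theorem conformalN_pd (h : ConformalFrame U Y ξ) (hu : u ∈ U) (l : Fin n) :
    ⟪conformalN Y u, pd l Y u⟫ = 0 := by
  rw [conformalN_eq, map_sub, map_smul, map_smul, LinearMap.sub_apply, LinearMap.smul_apply,
    LinearMap.smul_apply, h.laplacian_pd hu, pseudoForm_comm _ _ (Y u), h.pd_lift hu]
  simp

theorem conformalN_laplacian (h : ConformalFrame U Y ξ) (hu : u ∈ U) :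
    ⟪conformalN Y u, laplacian (inducedMetric Y) Y u⟫ = -(1 / (2 * (n : ℝ))) *
      ⟪laplacian (inducedMetric Y) Y u, laplacian (inducedMetric Y) Y u⟫ := by
  have := h.dim_cast_ne
  rw [conformalN_eq, map_sub, map_smul, map_smul, LinearMap.sub_apply, LinearMap.smul_apply,
    LinearMap.smul_apply, h.lift_laplacian hu, smul_eq_mul, smul_eq_mul]
  field_simp
  ring

/-- The coefficient 1/(2n²) in N is the one that makes N null, given ⟨Y, ΔY⟩ = -n. -/
theorem conformalN_conformalN (h : ConformalFrame U Y ξ) (hu : u ∈ U) :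
    ⟪conformalN Y u, conformalN Y u⟫ = 0 := by
  have := h.dim_cast_ne
  have h1 := h.conformalN_laplacian hu
  have h2 := h.conformalN_lift hu
  generalize hN : conformalN Y u = N at h1 h2 ⊢
  have h3 : ⟪N, N⟫ = ⟪N, conformalN Y u⟫ := by rw [hN]
  rw [h3, conformalN_eq, map_sub, map_smul, map_smul, h1, h2, smul_eq_mul, smul_eq_mul]
  field_simp
  ring

theorem pd_conformalN_lift (h : ConformalFrame U Y ξ) (hu : u ∈ U) (i : Fin n) :
    ⟪pd i (conformalN Y) u, Y u⟫ = 0 := by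
  have h1 := pd_pseudoForm (s := 2) (h.diff_conformalN hu) (h.diff hu) i
  rw [pd_eq_zero_of_eqOn_const h.isOpen (fun v hv => h.conformalN_lift hv) hu,
    h.conformalN_pd hu] at h1
  linarith

theorem pd_conformalN_conformalN (h : ConformalFrame U Y ξ) (hu : u ∈ U) (i : Fin n) :
    ⟪pd i (conformalN Y) u, conformalN Y u⟫ = 0 := by
  have h1 := pd_pseudoForm (s := 2) (h.diff_conformalN hu) (h.diff_conformalN hu) i
  rw [pd_eq_zero_of_eqOn_const h.isOpen (fun v hv => h.conformalN_conformalN hv) hu,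
    pseudoForm_comm _ _ (conformalN Y u)] at h1
  linarith

theorem pd_pd_conformalN (h : ConformalFrame U Y ξ) (hu : u ∈ U) (i j : Fin n) :
    ⟪pd i (pd j Y) u, conformalN Y u⟫ = -blaschkeTensor Y u i j := by
  have h1 := pd_pseudoForm (s := 2) (h.diff_conformalN hu) (h.diff_pd hu j) i
  rw [pd_eq_zero_of_eqOn_const h.isOpen (fun v hv => h.conformalN_pd hv j) hu] at h1
  rw [blaschkeTensor_apply, pseudoForm_comm]
  linarith

theorem pd_pd_normal (h : ConformalFrame U Y ξ) (hu : u ∈ U) (i j : Fin n) :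
    ⟪pd i (pd j Y) u, ξ u⟫ = -secondForm Y ξ u i j := by
  have h1 := pd_pseudoForm (s := 2) (h.diffNormal hu) (h.diff_pd hu j) i
  rw [pd_eq_zero_of_eqOn_const h.isOpen (fun v hv => h.normal_pd v hv j) hu] at h1
  rw [secondForm_apply, pseudoForm_comm]
  linarith

/-- Up to sign, Aᵢⱼ is the N-pairing of ∂ᵢ∂ⱼY, which is symmetric in i and j. -/
theorem blaschke_symm (h : ConformalFrame U Y ξ) (hu : u ∈ U) (i j : Fin n) :
    blaschkeTensor Y u i j = blaschkeTensor Y u j i := by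
  have h1 := h.pd_pd_conformalN hu i j
  rw [h.pd_pd_comm hu, h.pd_pd_conformalN hu] at h1
  linarith

theorem secondForm_symm (h : ConformalFrame U Y ξ) (hu : u ∈ U) (i j : Fin n) :
    secondForm Y ξ u i j = secondForm Y ξ u j i := by
  have h1 := h.pd_pd_normal hu i j
  rw [h.pd_pd_comm hu, h.pd_pd_normal hu] at h1
  linarith

/-- Since ξ is orthogonal to Y and N, it is orthogonal to ΔY, and ⟨ξ, ΔY⟩ is minus this trace. -/
theorem trace_raise_secondForm (h : ConformalFrame U Y ξ) (hu : u ∈ U) :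
    (raise (inducedMetric Y) (secondForm Y ξ) u).trace = 0 := by
  have hn := h.dim_cast_ne
  have h1 := h.normal_conformalN u hu
  rw [conformalN_eq, map_sub, map_smul, map_smul, h.normal_lift u hu, smul_zero, sub_zero,
    smul_eq_mul, mul_eq_zero, form_laplacian _ (h.normal_pd u hu)] at h1
  have h2 := h1.resolve_left (by simp [hn])
  simp only [pseudoForm_comm _ _ (ξ u), h.pd_pd_normal hu, mul_neg, Finset.sum_neg_distrib,
    sum_inv_mul] at h2
  rw [raise]
  linarith

/-- Compute ⟨N, ΔY⟩ twice: as -tr a from the second derivatives, and from the formula for N. -/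
theorem trace_raise_blaschke (h : ConformalFrame U Y ξ) (hu : u ∈ U) :
    2 * (n : ℝ) * (raise (inducedMetric Y) (blaschkeTensor Y) u).trace =
      ⟪laplacian (inducedMetric Y) Y u, laplacian (inducedMetric Y) Y u⟫ := by
  have hn := h.dim_cast_ne
  have h1 := h.conformalN_laplacian hu
  rw [form_laplacian _ (h.conformalN_pd hu)] at h1
  simp only [pseudoForm_comm _ _ (conformalN Y u), h.pd_pd_conformalN hu, mul_neg,
    Finset.sum_neg_distrib, sum_inv_mul] at h1
  rw [raise, neg_eq_iff_eq_neg.1 h1]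
  field_simp

/-- The frame `Y, N, ∂ᵢY, ξ` spans `ℝ^{n+3}`. -/
theorem eq_zero_of_orthogonal (h : ConformalFrame U Y ξ) (hu : u ∈ U) {w : Fin (n + 1 + 2) → ℝ}
    (h1 : ⟪w, Y u⟫ = 0) (h2 : ⟪w, conformalN Y u⟫ = 0) (h3 : ⟪w, ξ u⟫ = 0)
    (h4 : ∀ i, ⟪w, pd i Y u⟫ = 0) : w = 0 := by
  -- Pairing with the frame maps between spaces of the same dimension n + 3, so injectivity follows
  -- from surjectivity.
  let L : (Fin (n + 1 + 2) → ℝ) →ₗ[ℝ] (Fin n → ℝ) × ℝ × ℝ × ℝ :=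
    (LinearMap.pi fun i => (pseudoForm 2 (n + 1 + 2)).flip (pd i Y u)).prod
      (((pseudoForm 2 (n + 1 + 2)).flip (Y u)).prod
        (((pseudoForm 2 (n + 1 + 2)).flip (conformalN Y u)).prod
          ((pseudoForm 2 (n + 1 + 2)).flip (ξ u))))
  have hL : ∀ v, L v = (fun i => ⟪v, pd i Y u⟫, ⟪v, Y u⟫, ⟪v, conformalN Y u⟫, ⟪v, ξ u⟫) :=
    fun v => rfl
  have hsurj : Function.Surjective L := by
    rintro ⟨c, p, q, r⟩
    -- The dual frame: Y and N are dual to each other, tangential coefficients are raised by g⁻¹,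
    -- and ⟨ξ, ξ⟩ = -1 causes the minus sign.
    refine ⟨∑ k, ((inducedMetric Y u)⁻¹ *ᵥ c) k • pd k Y u + p • conformalN Y u + q • Y u
      - r • ξ u, ?_⟩
    have e1 := h.conformalN_lift hu
    have e2 := pseudoForm_comm 2 _ (Y u) (conformalN Y u)
    have e3 := fun i => pseudoForm_comm 2 _ (pd i Y u) (conformalN Y u)
    have e4 := fun i => pseudoForm_comm 2 _ (Y u) (pd i Y u)
    have e5 := fun i => pseudoForm_comm 2 _ (pd i Y u) (ξ u)
    have e6 := pseudoForm_comm 2 _ (Y u) (ξ u)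
    have e7 := pseudoForm_comm 2 _ (conformalN Y u) (ξ u)
    rw [hL]
    simp only [map_sub, map_add, map_sum, map_smul, LinearMap.sub_apply, LinearMap.add_apply,
      LinearMap.sum_apply, LinearMap.smul_apply, smul_eq_mul, e1, e2, e3, e4, e5, e6, e7,
      h.pd_lift hu, h.conformalN_pd hu, h.conformalN_conformalN hu, h.null u hu,
      h.normal_normal u hu, h.normal_lift u hu, h.normal_conformalN u hu, h.normal_pd u hu]
    refine Prod.ext ?_ ?_
    · have e8 : (inducedMetric Y u) *ᵥ ((inducedMetric Y u)⁻¹ *ᵥ c) = c := by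
        rw [Matrix.mulVec_mulVec, h.mul_inv hu, Matrix.one_mulVec]
      funext l
      simp only [mul_zero, add_zero, sub_zero]
      conv_rhs => rw [← e8]
      refine Finset.sum_congr rfl fun k _ => ?_
      change _ = inducedMetric Y u l k * _
      rw [inducedMetric_symm, inducedMetric_apply, mul_comm]
    · simp
  have hinj : Function.Injective L :=
    (LinearMap.injective_iff_surjective_of_finrank_eq_finrank (by simp)).2 hsurj
  refine hinj ?_
  rw [hL, map_zero, h1, h2, h3]
  exact Prod.ext (funext h4) rfl

/-- The structure equation for the second derivatives of the lift. -/
theorem pd_pd_eq (h : ConformalFrame U Y ξ) (hu : u ∈ U) (i j : Fin n) :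
    pd i (pd j Y) u = ∑ k, christoffel (inducedMetric Y) k i j u • pd k Y u
      - blaschkeTensor Y u i j • Y u - inducedMetric Y u i j • conformalN Y u
      + secondForm Y ξ u i j • ξ u := by
  have e2 := pseudoForm_comm 2 _ (Y u) (conformalN Y u)
  have e3 := fun i => pseudoForm_comm 2 _ (pd i Y u) (conformalN Y u)
  have e4 := fun i => pseudoForm_comm 2 _ (Y u) (pd i Y u)
  have e5 := fun i => pseudoForm_comm 2 _ (pd i Y u) (ξ u)
  have e6 := pseudoForm_comm 2 _ (Y u) (ξ u)
  have e7 := pseudoForm_comm 2 _ (conformalN Y u) (ξ u)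
  -- Both sides have the same pairing with every frame vector.
  refine sub_eq_zero.1 (h.eq_zero_of_orthogonal hu ?_ ?_ ?_ fun l => ?_)
  all_goals
    simp only [map_sub, map_add, map_sum, map_smul, LinearMap.sub_apply, LinearMap.add_apply,
      LinearMap.sum_apply, LinearMap.smul_apply, smul_eq_mul, h.conformalN_lift hu, e2, e3, e4, e5,
      e6, e7, h.pd_lift hu, h.conformalN_pd hu, h.conformalN_conformalN hu, h.null u hu,
      h.normal_normal u hu, h.normal_lift u hu, h.normal_conformalN u hu, h.normal_pd u hu,
      h.pd_pd_lift hu, h.pd_pd_conformalN hu, h.pd_pd_normal hu, ← h.sum_christoffel_metric hu i j,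
      ← inducedMetric_apply]
    simp

/-- The structure equation for the derivatives of `N`. -/
theorem pd_conformalN_eq (h : ConformalFrame U Y ξ) (hu : u ∈ U) (i : Fin n) :
    pd i (conformalN Y) u =
      ∑ k, raise (inducedMetric Y) (blaschkeTensor Y) u k i • pd k Y u
        - conformalForm Y ξ i u • ξ u := by
  have e3 := fun i => pseudoForm_comm 2 _ (pd i Y u) (conformalN Y u)
  have e5 := fun i => pseudoForm_comm 2 _ (pd i Y u) (ξ u)
  refine sub_eq_zero.1 (h.eq_zero_of_orthogonal hu ?_ ?_ ?_ fun l => ?_)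
  all_goals
    simp only [map_sub, map_sum, map_smul, LinearMap.sub_apply,
      LinearMap.sum_apply, LinearMap.smul_apply, smul_eq_mul, e3, e5,
      h.pd_lift hu, h.conformalN_pd hu,
      h.normal_normal u hu, h.normal_lift u hu, h.normal_conformalN u hu, h.normal_pd u hu,
      h.pd_conformalN_lift hu, h.pd_conformalN_conformalN hu,
      ← inducedMetric_apply, ← blaschkeTensor_apply]
  · simp
  · simp
  · simp [conformalForm]
  · have e8 : (inducedMetric Y u * raise (inducedMetric Y) (blaschkeTensor Y) u) l i =
        blaschkeTensor Y u l i := by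
      rw [raise, ← Matrix.mul_assoc, h.mul_inv hu, Matrix.one_mul]
    rw [h.blaschke_symm hu, ← e8, Matrix.mul_apply, mul_zero, sub_zero, sub_eq_zero]
    exact Finset.sum_congr rfl fun k _ => by rw [inducedMetric_symm, mul_comm]

end ConformalFrame

end Frame

/-! ### The equations of Gauss, Codazzi and Ricci -/

section IntegrabilityConditions

open Matrix

variable {n : ℕ}

local notation "⟪" v ", " w "⟫" => pseudoForm 2 _ v w

/-- The matrix form turns the index computations below into noncommutative ring identities. -/
theorem covDeriv_eq (g T : EuclideanSpace ℝ (Fin n) → Matrix (Fin n) (Fin n) ℝ) (i j k : Fin n)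
    (u : EuclideanSpace ℝ (Fin n)) :
    covDeriv g T i j k u =
      (mpd k T u - ((connection g k u)ᵀ * T u + T u * connection g k u)) i j := by
  simp only [covDeriv, mpd, connection, Matrix.sub_apply, Matrix.add_apply, Matrix.mul_apply,
    Matrix.of_apply, Matrix.transpose_apply, Finset.sum_add_distrib]
  congr 2
  exact Finset.sum_congr rfl fun l _ => mul_comm _ _

theorem ricci_eq_sum_curvature (g : EuclideanSpace ℝ (Fin n) → Matrix (Fin n) (Fin n) ℝ)
    (j k : Fin n) (u : EuclideanSpace ℝ (Fin n)) :
    ricci g j k u = ∑ i, curvature g i j u i k := by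
  refine Finset.sum_congr rfl fun i _ => ?_
  simp only [curvature, mpd, connection, Matrix.sub_apply, Matrix.add_apply, Matrix.mul_apply,
    Matrix.of_apply, Finset.sum_sub_distrib]

/-- The Ricci identity: the curvature commutes with a parallel endomorphism field. -/
theorem curvature_commute {U : Set (EuclideanSpace ℝ (Fin n))} (hU : IsOpen U)
    {g a : EuclideanSpace ℝ (Fin n) → Matrix (Fin n) (Fin n) ℝ}
    (hg : ∀ i, MatSmoothOn U (connection g i)) (ha : MatSmoothOn U a)
    (hp : ∀ v ∈ U, ∀ k, mpd k a v = a v * connection g k v - connection g k v * a v)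
    {u : EuclideanSpace ℝ (Fin n)} (hu : u ∈ U) (i j : Fin n) :
    curvature g i j u * a u = a u * curvature g i j u := by
  have key : ∀ i j, mpd i (mpd j a) u =
      (a u * connection g i u - connection g i u * a u) * connection g j u
        + a u * mpd i (connection g j) u
        - (mpd i (connection g j) u * a u
          + connection g j u * (a u * connection g i u - connection g i u * a u)) := by
    intro i j
    rw [mpd_congr hU (fun v hv => hp v hv j) hu, mpd_sub hU (ha.mul (hg j)) ((hg j).mul ha) hu,
      mpd_mul hU ha (hg j) hu, mpd_mul hU (hg j) ha hu, hp u hu]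
  -- Equality of mixed partials of `a`: the terms linear in derivatives of the connection and the
  -- quadratic ones combine to the commutator of curvature and `a`.
  have h1 := mpd_comm hU ha hu i j
  rw [key, key] at h1
  rw [curvature, ← sub_eq_zero]
  rw [← sub_eq_zero] at h1
  rw [← neg_eq_zero, ← h1]
  noncomm_ring

namespace ConformalFrame

variable {U : Set (EuclideanSpace ℝ (Fin n))} {u : EuclideanSpace ℝ (Fin n)}
  {Y ξ : EuclideanSpace ℝ (Fin n) → (Fin (n + 1 + 2) → ℝ)}

theorem metric_mul_connection (h : ConformalFrame U Y ξ) (hu : u ∈ U) (i m j : Fin n) :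
    (inducedMetric Y u * connection (inducedMetric Y) i u) m j =
      ⟪pd i (pd j Y) u, pd m Y u⟫ := by
  rw [← h.sum_christoffel_metric hu, Matrix.mul_apply]
  refine Finset.sum_congr rfl fun k _ => ?_
  rw [inducedMetric_symm, mul_comm]
  rfl

/-- Metric compatibility of the Levi-Civita connection, ∇g = 0. -/
theorem mpd_metric (h : ConformalFrame U Y ξ) (hu : u ∈ U) (k : Fin n) :
    mpd k (inducedMetric Y) u =
      (connection (inducedMetric Y) k u)ᵀ * inducedMetric Y u
        + inducedMetric Y u * connection (inducedMetric Y) k u := by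
  ext i j
  rw [Matrix.add_apply, ← inducedMetric_transpose, ← Matrix.transpose_mul,
    inducedMetric_transpose, Matrix.transpose_apply, h.metric_mul_connection hu,
    h.metric_mul_connection hu]
  exact h.pd_metric hu i j k

theorem metric_mul_raise (h : ConformalFrame U Y ξ) (hu : u ∈ U)
    (T : EuclideanSpace ℝ (Fin n) → Matrix (Fin n) (Fin n) ℝ) :
    inducedMetric Y u * raise (inducedMetric Y) T u = T u := by
  rw [raise, ← Matrix.mul_assoc, h.mul_inv hu, Matrix.one_mul]

theorem smooth_raise (h : ConformalFrame U Y ξ)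
    {T : EuclideanSpace ℝ (Fin n) → Matrix (Fin n) (Fin n) ℝ} (hT : MatSmoothOn U T) :
    MatSmoothOn U (raise (inducedMetric Y) T) := h.smooth_inv.mul hT

/-- A covariant 2-tensor is parallel if and only if the associated endomorphism field is. -/
theorem covDeriv_eq_zero_iff (h : ConformalFrame U Y ξ) (hu : u ∈ U)
    {T : EuclideanSpace ℝ (Fin n) → Matrix (Fin n) (Fin n) ℝ} (hT : MatSmoothOn U T)
    (k : Fin n) :
    (∀ i j, covDeriv (inducedMetric Y) T i j k u = 0) ↔
      mpd k (raise (inducedMetric Y) T) u =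
        raise (inducedMetric Y) T u * connection (inducedMetric Y) k u
          - connection (inducedMetric Y) k u * raise (inducedMetric Y) T u := by
  have h1 : mpd k T u = mpd k (inducedMetric Y) u * raise (inducedMetric Y) T u
      + inducedMetric Y u * mpd k (raise (inducedMetric Y) T) u := by
    rw [← mpd_mul h.isOpen h.smooth_metric (h.smooth_raise hT) hu]
    exact mpd_congr h.isOpen (fun v hv => (h.metric_mul_raise hv T).symm) hu k
  -- Because ∇g = 0, lowering an index commutes with ∇: ∇T = g ∇(g⁻¹T).
  have h2 : mpd k T u - ((connection (inducedMetric Y) k u)ᵀ * T u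
      + T u * connection (inducedMetric Y) k u) =
      inducedMetric Y u * (mpd k (raise (inducedMetric Y) T) u
        - (raise (inducedMetric Y) T u * connection (inducedMetric Y) k u
          - connection (inducedMetric Y) k u * raise (inducedMetric Y) T u)) := by
    rw [h1, h.mpd_metric hu]
    conv_lhs => rw [← h.metric_mul_raise hu T]
    noncomm_ring
  simp only [covDeriv_eq, h2]
  rw [← sub_eq_zero (a := mpd k (raise (inducedMetric Y) T) u)]
  constructor
  · intro h3
    have h4 := Matrix.ext h3
    calc _ = (inducedMetric Y u)⁻¹ * (inducedMetric Y u * _) := by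
          rw [← Matrix.mul_assoc, h.inv_mul hu, Matrix.one_mul]
      _ = 0 := by rw [h4]; exact Matrix.mul_zero _
  · intro h3 i j
    rw [h3, Matrix.mul_zero, Matrix.zero_apply]

/-- The Codazzi equation for the Blaschke tensor. -/
theorem codazzi (h : ConformalFrame U Y ξ) (hu : u ∈ U) (i j k : Fin n) :
    covDeriv (inducedMetric Y) (blaschkeTensor Y) i j k u
      - covDeriv (inducedMetric Y) (blaschkeTensor Y) k j i u =
      secondForm Y ξ u k j * conformalForm Y ξ i u
        - secondForm Y ξ u i j * conformalForm Y ξ k u := by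
  -- In ⟨∂ᵢN, ∂ₖ∂ⱼY⟩ the Y and N components of the structure equation drop out, since ∂ᵢN is
  -- orthogonal to both. The other term, ⟨∂ₖ∂ᵢN, ∂ⱼY⟩, cancels on exchanging i and k.
  have h1 : ∀ i k, pd k (fun v => blaschkeTensor Y v i j) u =
      ⟪pd k (pd i (conformalN Y)) u, pd j Y u⟫
        + (∑ l, christoffel (inducedMetric Y) l k j u * blaschkeTensor Y u i l
          + secondForm Y ξ u k j * conformalForm Y ξ i u) := by
    intro i k
    have h2 := pd_pseudoForm (s := 2) (differentiableAt_of_contDiffOn h.isOpen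
      (contDiffOn_pd h.isOpen h.smooth_conformalN i) hu) (h.diff_pd hu j) k
    rw [h.pd_pd_eq hu k j] at h2
    simp only [map_sub, map_add, map_sum, map_smul, smul_eq_mul, h.pd_conformalN_lift hu,
      h.pd_conformalN_conformalN hu, ← blaschkeTensor_apply] at h2
    simpa [conformalForm] using h2
  rw [covDeriv, covDeriv, h1, h1, pd_comm h.isOpen h.smooth_conformalN hu k i]
  simp only [Finset.sum_add_distrib, h.christoffel_symm hu _ i k]
  ring

/-- The conformal form vanishes if the Blaschke tensor is parallel and the second fundamental
form does not vanish. -/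
theorem conformalForm_eq_zero (h : ConformalFrame U Y ξ) (hu : u ∈ U)
    (hA : ∀ i j k, covDeriv (inducedMetric Y) (blaschkeTensor Y) i j k u = 0)
    (hB : secondForm Y ξ u ≠ 0) (i : Fin n) : conformalForm Y ξ i u = 0 := by
  set c : Fin n → ℝ := fun i => conformalForm Y ξ i u with hc
  have h1 : ∀ i j k, secondForm Y ξ u k j * c i = secondForm Y ξ u i j * c k := by
    intro i j k
    have := h.codazzi hu i j k
    rw [hA, hA, sub_zero] at this
    exact (sub_eq_zero.1 this.symm)
  set d : Fin n → ℝ := (inducedMetric Y u)⁻¹ *ᵥ c with hd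
  -- Contracting `h1` over j and k gives B d = (tr b) c, which is zero.
  have h2 : ∀ i, (secondForm Y ξ u *ᵥ d) i = 0 := by
    intro i
    have h3 := h.trace_raise_secondForm hu
    rw [raise, ← sum_inv_mul] at h3
    have h4 : (secondForm Y ξ u *ᵥ d) i =
        (∑ j, ∑ k, (inducedMetric Y u)⁻¹ j k * secondForm Y ξ u j k) * c i := by
      simp only [hd, Matrix.mulVec, dotProduct, Finset.mul_sum, Finset.sum_mul]
      refine Finset.sum_congr rfl fun j _ => Finset.sum_congr rfl fun k _ => ?_
      rw [h.secondForm_symm hu j k, mul_assoc, h1 i j k]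
      ring
    rw [h4, h3, zero_mul]
  -- Contracting `h1` with `d` over i gives |c|² B = (B d) ⊗ c = 0; as B ≠ 0, the norm of c
  -- vanishes.
  have h5 : ∀ j k, secondForm Y ξ u k j * (c ⬝ᵥ d) = 0 := by
    intro j k
    have h6 : secondForm Y ξ u k j * (c ⬝ᵥ d) = (secondForm Y ξ u *ᵥ d) j * c k := by
      simp only [dotProduct, Matrix.mulVec, Finset.mul_sum, Finset.sum_mul]
      refine Finset.sum_congr rfl fun i _ => ?_
      rw [← mul_assoc, h1 i j k, h.secondForm_symm hu i j]
      ring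
    rw [h6, h2, zero_mul]
  have h7 : c ⬝ᵥ d = 0 := by
    by_contra hne
    refine hB (Matrix.ext fun k j => ?_)
    exact (mul_eq_zero.1 (h5 j k)).resolve_right hne
  by_contra hne
  have h8 := (h.posDef u hu).inv.dotProduct_mulVec_pos (x := c) fun h0 => hne (congrFun h0 i)
  simp only [star_trivial] at h8
  exact h8.ne' h7

/-- If the conformal form vanishes, the Blaschke tensor and the second fundamental form commute. -/
theorem raise_commute (h : ConformalFrame U Y ξ) (hC : ∀ v ∈ U, ∀ i, conformalForm Y ξ i v = 0)
    (hu : u ∈ U) :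
    raise (inducedMetric Y) (blaschkeTensor Y) u * raise (inducedMetric Y) (secondForm Y ξ) u =
      raise (inducedMetric Y) (secondForm Y ξ) u
        * raise (inducedMetric Y) (blaschkeTensor Y) u := by
  -- Differentiate ⟨∂ᵢN, ξ⟩ = 0, with ∂ᵢN tangential. The right side is symmetric in i and j, hence
  -- so is B a.
  have h1 : ∀ i j, (secondForm Y ξ u * raise (inducedMetric Y) (blaschkeTensor Y) u) j i =
      -⟪pd j (pd i (conformalN Y)) u, ξ u⟫ := by
    intro i j
    have h2 := pd_pseudoForm (s := 2) (differentiableAt_of_contDiffOn h.isOpen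
      (contDiffOn_pd h.isOpen h.smooth_conformalN i) hu) (h.diffNormal hu) j
    have h0 : pd j (fun v => ⟪pd i (conformalN Y) v, ξ v⟫) u = 0 :=
      pd_eq_zero_of_eqOn_const (c := (0 : ℝ)) h.isOpen (fun v hv => hC v hv i) hu j
    rw [h0, h.pd_conformalN_eq hu i, hC u hu, zero_smul, sub_zero] at h2
    simp only [map_sum, map_smul, LinearMap.sum_apply, LinearMap.smul_apply, smul_eq_mul,
      pseudoForm_comm 2 _ (pd _ Y u) (pd j ξ u), ← secondForm_apply] at h2
    rw [Matrix.mul_apply, eq_neg_iff_add_eq_zero, h2, add_comm]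
    simp only [mul_comm]
  have h3 : (secondForm Y ξ u * raise (inducedMetric Y) (blaschkeTensor Y) u)ᵀ =
      secondForm Y ξ u * raise (inducedMetric Y) (blaschkeTensor Y) u := by
    ext i j
    rw [Matrix.transpose_apply, h1, h1, pd_comm h.isOpen h.smooth_conformalN hu]
  have hA : (blaschkeTensor Y u)ᵀ = blaschkeTensor Y u := by
    ext i j; exact h.blaschke_symm hu j i
  have hB : (secondForm Y ξ u)ᵀ = secondForm Y ξ u := by
    ext i j; exact h.secondForm_symm hu j i
  rw [raise, Matrix.transpose_mul, Matrix.transpose_mul, hA, hB, Matrix.transpose_nonsing_inv,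
    inducedMetric_transpose, Matrix.mul_assoc] at h3
  simp only [raise]
  rw [Matrix.mul_assoc, Matrix.mul_assoc, h3]

/-- The tangential parts give the connection product, the normal parts the Gauss terms; the sign of
the B product comes from ξ being timelike. -/
theorem form_pd_pd (h : ConformalFrame U Y ξ) (hu : u ∈ U) (i m j k : Fin n) :
    ⟪pd i (pd m Y) u, pd j (pd k Y) u⟫ =
      ((connection (inducedMetric Y) i u)ᵀ
        * (inducedMetric Y u * connection (inducedMetric Y) j u)) m k
      + (blaschkeTensor Y u j k * inducedMetric Y u i m
        + inducedMetric Y u j k * blaschkeTensor Y u i m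
        - secondForm Y ξ u j k * secondForm Y ξ u i m) := by
  rw [← Matrix.mul_assoc, ← inducedMetric_transpose, ← Matrix.transpose_mul,
    inducedMetric_transpose, Matrix.mul_apply, h.pd_pd_eq hu j k]
  simp only [map_sub, map_add, map_sum, map_smul, smul_eq_mul, Matrix.transpose_apply,
    h.metric_mul_connection hu, h.pd_pd_lift hu, h.pd_pd_conformalN hu, h.pd_pd_normal hu]
  simp only [connection, Matrix.of_apply, mul_comm (christoffel _ _ _ _ _)]
  ring

/-- The Gauss equation. -/
theorem gauss (h : ConformalFrame U Y ξ) (hu : u ∈ U) (i j m k : Fin n) :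
    (inducedMetric Y u * curvature (inducedMetric Y) i j u) m k =
      (blaschkeTensor Y u j k * inducedMetric Y u i m
        + inducedMetric Y u j k * blaschkeTensor Y u i m
        - secondForm Y ξ u j k * secondForm Y ξ u i m)
      - (blaschkeTensor Y u i k * inducedMetric Y u j m
        + inducedMetric Y u i k * blaschkeTensor Y u j m
        - secondForm Y ξ u i k * secondForm Y ξ u j m) := by
  -- Differentiate g Γⱼ = ⟨∂ⱼ∂ₖY, ∂ₘY⟩ in direction i. Antisymmetrizing in i and j cancels the third
  -- derivatives of Y.
  have h1 : ∀ i j, (((connection (inducedMetric Y) i u)ᵀ * inducedMetric Y u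
        + inducedMetric Y u * connection (inducedMetric Y) i u) * connection (inducedMetric Y) j u
      + inducedMetric Y u * mpd i (connection (inducedMetric Y) j) u) m k =
      ⟪pd i (pd j (pd k Y)) u, pd m Y u⟫ + ⟪pd i (pd m Y) u, pd j (pd k Y) u⟫ := by
    intro i j
    rw [← h.mpd_metric hu, ← mpd_mul h.isOpen h.smooth_metric (h.smooth_connection j) hu,
      pseudoForm_comm 2 _ (pd i (pd m Y) u), ← pd_pseudoForm (differentiableAt_of_contDiffOn
        h.isOpen (contDiffOn_pd h.isOpen (h.smooth_pd k) j) hu) (h.diff_pd hu m)]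
    exact pd_congr_of_eqOn h.isOpen (fun v hv => h.metric_mul_connection hv j m k) hu i
  have h2 := h1 i j
  have h3 := h1 j i
  rw [pd_comm h.isOpen (h.smooth_pd k) hu j i] at h3
  rw [h.form_pd_pd hu] at h2 h3
  have e : inducedMetric Y u * curvature (inducedMetric Y) i j u =
      ((((connection (inducedMetric Y) i u)ᵀ * inducedMetric Y u
        + inducedMetric Y u * connection (inducedMetric Y) i u) * connection (inducedMetric Y) j u
      + inducedMetric Y u * mpd i (connection (inducedMetric Y) j) u)
      - (connection (inducedMetric Y) i u)ᵀ
        * (inducedMetric Y u * connection (inducedMetric Y) j u))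
      - ((((connection (inducedMetric Y) j u)ᵀ * inducedMetric Y u
        + inducedMetric Y u * connection (inducedMetric Y) j u) * connection (inducedMetric Y) i u
      + inducedMetric Y u * mpd j (connection (inducedMetric Y) i) u)
      - (connection (inducedMetric Y) j u)ᵀ
        * (inducedMetric Y u * connection (inducedMetric Y) i u)) := by
    rw [curvature]
    noncomm_ring
  rw [e, Matrix.sub_apply, Matrix.sub_apply, Matrix.sub_apply, h2, h3]
  ring

/-- This extends the Gauss equation from coordinate planes to arbitrary vectors, so that the Ricci
identity can be tested on eigenvectors. -/
theorem sum_smul_curvature (h : ConformalFrame U Y ξ) (hu : u ∈ U) (V W Z : Fin n → ℝ) :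
    gaussCurvature (inducedMetric Y u) (raise (inducedMetric Y) (blaschkeTensor Y) u)
        (raise (inducedMetric Y) (secondForm Y ξ) u) V W Z =
      ∑ i, ∑ j, (V i * W j) • (curvature (inducedMetric Y) i j u *ᵥ Z) := by
  have hinj : ∀ v w : Fin n → ℝ, inducedMetric Y u *ᵥ v = inducedMetric Y u *ᵥ w → v = w := by
    intro v w hvw
    rw [← Matrix.one_mulVec v, ← h.inv_mul hu, ← Matrix.mulVec_mulVec, hvw, Matrix.mulVec_mulVec,
      h.inv_mul hu, Matrix.one_mulVec]
  have hsum : ∀ (P Q : Matrix (Fin n) (Fin n) ℝ) (V W : Fin n → ℝ) (m : Fin n),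
      (Z ⬝ᵥ P *ᵥ W) * (Q *ᵥ V) m =
        ∑ i, ∑ j, ∑ k, V i * W j * (P k j * Q m i * Z k) := by
    intro P Q V W m
    simp only [dotProduct, Matrix.mulVec, Finset.mul_sum, Finset.sum_mul]
    refine Finset.sum_congr rfl fun i _ => ?_
    rw [Finset.sum_comm]
    exact Finset.sum_congr rfl fun j _ => Finset.sum_congr rfl fun k _ => by ring
  have hsum' : ∀ (P Q : Matrix (Fin n) (Fin n) ℝ) (m : Fin n),
      (Z ⬝ᵥ P *ᵥ V) * (Q *ᵥ W) m =
        ∑ i, ∑ j, ∑ k, V i * W j * (P k i * Q m j * Z k) := by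
    intro P Q m
    rw [hsum, Finset.sum_comm]
    refine Finset.sum_congr rfl fun i _ => Finset.sum_congr rfl fun j _ =>
      Finset.sum_congr rfl fun k _ => by ring
  refine hinj _ _ (funext fun m => ?_)
  simp only [gaussCurvature, Matrix.mulVec_sub, Matrix.mulVec_add, Matrix.mulVec_smul,
    Matrix.mulVec_sum, Matrix.mulVec_mulVec, h.metric_mul_raise hu, Pi.sub_apply, Pi.add_apply,
    Pi.smul_apply, Finset.sum_apply, smul_eq_mul, hsum _ _ V W, hsum']
  simp only [← Finset.sum_add_distrib, ← Finset.sum_sub_distrib]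
  refine Finset.sum_congr rfl fun i _ => Finset.sum_congr rfl fun j _ => ?_
  simp only [Matrix.mulVec, dotProduct, Finset.mul_sum, h.gauss hu]
  refine Finset.sum_congr rfl fun k _ => ?_
  rw [h.blaschke_symm hu k j, h.blaschke_symm hu k i, h.blaschke_symm hu m j,
    h.blaschke_symm hu m i, h.secondForm_symm hu k j, h.secondForm_symm hu k i,
    h.secondForm_symm hu m j, h.secondForm_symm hu m i, inducedMetric_symm Y u k j,
    inducedMetric_symm Y u k i, inducedMetric_symm Y u m j, inducedMetric_symm Y u m i]
  ring

/-- Where the second fundamental form vanishes, so does the conformal factor. -/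
theorem conformalFactor_eq_zero (h : ConformalFrame U Y ξ) (hu : u ∈ U) (hn : n ≠ 1)
    (hB : secondForm Y ξ u = 0) : conformalFactor Y u = 0 := by
  set a := raise (inducedMetric Y) (blaschkeTensor Y) u with ha
  have hone : ∀ l i, ∑ m, (inducedMetric Y u)⁻¹ l m * inducedMetric Y u i m =
      (1 : Matrix (Fin n) (Fin n) ℝ) l i := by
    intro l i
    rw [← h.inv_mul hu, Matrix.mul_apply]
    exact Finset.sum_congr rfl fun m _ => by rw [inducedMetric_symm]
  have hra : ∀ l i, ∑ m, (inducedMetric Y u)⁻¹ l m * blaschkeTensor Y u i m = a l i := by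
    intro l i
    rw [ha, raise, Matrix.mul_apply]
    exact Finset.sum_congr rfl fun m _ => by rw [h.blaschke_symm hu]
  have hcurv : ∀ i j l k, curvature (inducedMetric Y) i j u l k =
      blaschkeTensor Y u j k * (1 : Matrix (Fin n) (Fin n) ℝ) l i + inducedMetric Y u j k * a l i
      - (blaschkeTensor Y u i k * (1 : Matrix (Fin n) (Fin n) ℝ) l j
        + inducedMetric Y u i k * a l j) := by
    intro i j l k
    rw [← Matrix.one_mul (curvature _ _ _ _), ← h.inv_mul hu, Matrix.mul_assoc, Matrix.mul_apply]
    simp only [h.gauss hu, hB, Matrix.zero_apply, mul_zero, sub_zero]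
    rw [h.inv_mul hu, ← hone, ← hone, ← hra, ← hra]
    simp only [Finset.mul_sum, ← Finset.sum_add_distrib, ← Finset.sum_sub_distrib]
    exact Finset.sum_congr rfl fun m _ => by ring
  have hric : ∀ j k, ricci (inducedMetric Y) j k u =
      ((n : ℝ) - 2) * blaschkeTensor Y u j k + a.trace * inducedMetric Y u j k := by
    intro j k
    have h1 : ∑ i, inducedMetric Y u i k * a i j = blaschkeTensor Y u j k := by
      rw [h.blaschke_symm hu, ← h.metric_mul_raise hu (blaschkeTensor Y), Matrix.mul_apply]
      exact Finset.sum_congr rfl fun i _ => by rw [inducedMetric_symm]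
    rw [ricci_eq_sum_curvature]
    simp only [hcurv, Finset.sum_sub_distrib, Finset.sum_add_distrib, h1, ← Finset.mul_sum,
      Matrix.one_apply_eq, Finset.sum_const, Finset.card_univ, Fintype.card_fin, nsmul_eq_mul]
    simp only [Matrix.one_apply, mul_ite, mul_one, mul_zero, Finset.sum_ite_eq', Finset.mem_univ,
      if_true]
    simp only [Matrix.trace, Matrix.diag]
    ring
  have hscal : ∑ j, ∑ k, (inducedMetric Y u)⁻¹ j k * ricci (inducedMetric Y) j k u =
      2 * ((n : ℝ) - 1) * a.trace := by
    have h1 := sum_inv_mul (Y := Y) (u := u) (((n : ℝ) - 2) • blaschkeTensor Y u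
      + a.trace • inducedMetric Y u)
    rw [Matrix.mul_add, mul_smul_comm, mul_smul_comm, h.inv_mul hu, Matrix.trace_add,
      Matrix.trace_smul, Matrix.trace_smul, Matrix.trace_one, Fintype.card_fin, smul_eq_mul,
      smul_eq_mul] at h1
    simp only [hric]
    refine h1.trans ?_
    change ((n : ℝ) - 2) * a.trace + _ = _
    ring
  have hn0 := h.dim_cast_ne
  -- For n = 1 the division defining κ has the default value 0; for other n one gets n²κ = 2n tr a,
  -- which equals ⟨ΔY, ΔY⟩.
  have hn1 : (n : ℝ) - 1 ≠ 0 := sub_ne_zero.2 (by exact_mod_cast hn)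
  rw [conformalFactor, pseudoInner_eq_form, ← h.trace_raise_blaschke hu,
    normalizedScalarCurvature, hscal, ← ha]
  field_simp
  ring

end ConformalFrame

end IntegrabilityConditions

/-! ### Parallel endomorphism fields -/

section ParallelTensors

open Matrix

variable {n : ℕ} {U : Set (EuclideanSpace ℝ (Fin n))} {u : EuclideanSpace ℝ (Fin n)}

theorem covDeriv_congr (hU : IsOpen U)
    {g g' : EuclideanSpace ℝ (Fin n) → Matrix (Fin n) (Fin n) ℝ} (hg : Set.EqOn g g' U)
    (hu : u ∈ U) (T : EuclideanSpace ℝ (Fin n) → Matrix (Fin n) (Fin n) ℝ) (i j k : Fin n) :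
    covDeriv g T i j k u = covDeriv g' T i j k u := by
  have h1 : ∀ i j k, pd k (fun v => g v i j) u = pd k (fun v => g' v i j) u := fun i j k =>
    pd_congr_of_eqOn hU (fun v hv => by rw [hg hv]) hu k
  simp only [covDeriv, christoffel, h1, hg hu]

/-- An endomorphism field is parallel for the connection with matrices `Γ k`. -/
def IsParallelOn (U : Set (EuclideanSpace ℝ (Fin n)))
    (Γ : Fin n → EuclideanSpace ℝ (Fin n) → Matrix (Fin n) (Fin n) ℝ)
    (T : EuclideanSpace ℝ (Fin n) → Matrix (Fin n) (Fin n) ℝ) : Prop :=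
  ∀ v ∈ U, ∀ k, mpd k T v = T v * Γ k v - Γ k v * T v

variable {Γ : Fin n → EuclideanSpace ℝ (Fin n) → Matrix (Fin n) (Fin n) ℝ}
  {S T : EuclideanSpace ℝ (Fin n) → Matrix (Fin n) (Fin n) ℝ}

theorem IsParallelOn.mul (hU : IsOpen U) (hS : MatSmoothOn U S) (hT : MatSmoothOn U T)
    (hSp : IsParallelOn U Γ S) (hTp : IsParallelOn U Γ T) :
    IsParallelOn U Γ fun v => S v * T v := by
  intro v hv k
  rw [mpd_mul hU hS hT hv, hSp v hv, hTp v hv]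
  noncomm_ring

theorem IsParallelOn.sub_smul_one (hU : IsOpen U) (hT : MatSmoothOn U T)
    (hTp : IsParallelOn U Γ T) (l : ℝ) :
    IsParallelOn U Γ fun v => T v - l • (1 : Matrix (Fin n) (Fin n) ℝ) := by
  intro v hv k
  rw [mpd_sub hU hT (MatSmoothOn.const _) hv, mpd_const, hTp v hv]
  simp only [sub_mul, mul_sub, smul_mul_assoc, mul_smul_comm, mul_one, one_mul]
  abel

theorem MatSmoothOn.cubic (hT : MatSmoothOn U T) (l₁ l₂ l₃ : ℝ) :
    MatSmoothOn U fun v => cubic l₁ l₂ l₃ (T v) :=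
  ((hT.sub (.const _)).mul (hT.sub (.const _))).mul (hT.sub (.const _))

theorem IsParallelOn.cubic (hU : IsOpen U) (hT : MatSmoothOn U T) (hTp : IsParallelOn U Γ T)
    (l₁ l₂ l₃ : ℝ) : IsParallelOn U Γ fun v => cubic l₁ l₂ l₃ (T v) :=
  .mul hU ((hT.sub (.const _)).mul (hT.sub (.const _))) (hT.sub (.const _))
    (.mul hU (hT.sub (.const _)) (hT.sub (.const _)) (hTp.sub_smul_one hU hT _)
      (hTp.sub_smul_one hU hT _)) (hTp.sub_smul_one hU hT _)

/-- The trace of a parallel endomorphism field is constant on convex sets. -/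
theorem IsParallelOn.trace_eq (hU : IsOpen U) (hc : Convex ℝ U) (hT : MatSmoothOn U T)
    (hTp : IsParallelOn U Γ T) {v w : EuclideanSpace ℝ (Fin n)} (hv : v ∈ U) (hw : w ∈ U) :
    (T v).trace = (T w).trace := by
  refine hU.is_const_of_fderiv_eq_zero (𝕜 := ℝ) (f := fun v => (T v).trace) hc.isPreconnected
    ((contDiffOn_trace hT).differentiableOn (by simp)) (fun z hz => ?_) hv hw
  refine fderiv_eq_zero_of_pd_eq_zero fun k => ?_
  rw [pd_trace hU hT hz, hTp z hz, Matrix.trace_sub, Matrix.trace_mul_comm, sub_self]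

/-- The relation aᵀg = ga moves g past each factor, and the factors commute. -/
theorem isSelfAdj_cubic {g a : Matrix (Fin n) (Fin n) ℝ} (hg : gᵀ = g) (ha : IsSelfAdj g a)
    (l₁ l₂ l₃ : ℝ) : IsSelfAdj g (cubic l₁ l₂ l₃ a) := by
  have h1 : ∀ l : ℝ, (a - l • (1 : Matrix (Fin n) (Fin n) ℝ))ᵀ * g =
      g * (a - l • (1 : Matrix (Fin n) (Fin n) ℝ)) := by
    intro l
    have h2 : aᵀ * g = g * a := by
      rw [IsSelfAdj, Matrix.transpose_mul, hg] at ha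
      exact ha
    rw [Matrix.transpose_sub, Matrix.transpose_smul, Matrix.transpose_one, Matrix.sub_mul, h2,
      Matrix.mul_sub, smul_mul_assoc, mul_smul_comm, Matrix.one_mul, Matrix.mul_one]
  rw [IsSelfAdj, cubic, Matrix.transpose_mul, hg, Matrix.transpose_mul, Matrix.transpose_mul,
    Matrix.mul_assoc, Matrix.mul_assoc, h1, ← Matrix.mul_assoc _ g, h1, Matrix.mul_assoc,
    ← Matrix.mul_assoc _ g, h1, Matrix.mul_assoc, sub_smul_one_commute a l₁ l₂,
    ← Matrix.mul_assoc _ _ (a - l₁ • (1 : Matrix (Fin n) (Fin n) ℝ)), sub_smul_one_commute a l₃ l₂,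
    Matrix.mul_assoc, sub_smul_one_commute a l₃ l₁]
  simp only [Matrix.mul_assoc]

/-- The eigenvalues of a matrix annihilated by a cubic are among the roots of the cubic. -/
theorem eigenvalue_of_cubic_eq_zero {a : Matrix (Fin n) (Fin n) ℝ} {l₁ l₂ l₃ l : ℝ}
    (hq : cubic l₁ l₂ l₃ a = 0) {v : Fin n → ℝ} (hv : v ≠ 0) (h : a *ᵥ v = l • v) :
    l = l₁ ∨ l = l₂ ∨ l = l₃ := by
  have h1 : cubic l₁ l₂ l₃ a *ᵥ v = ((l - l₁) * (l - l₂) * (l - l₃)) • v := by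
    rw [cubic, ← Matrix.mulVec_mulVec, ← Matrix.mulVec_mulVec]
    simp only [Matrix.mulVec_smul, sub_smul_one_mulVec, h, ← sub_smul]
    module
  rw [hq, Matrix.zero_mulVec] at h1
  have h2 := (smul_eq_zero.1 h1.symm).resolve_right hv
  simpa [sub_eq_zero, or_assoc] using h2

/-- The set of real eigenvalues. -/
def eigenvalueSet (a : Matrix (Fin n) (Fin n) ℝ) : Set ℝ :=
  {l : ℝ | Module.End.HasEigenvalue (Matrix.toLin' a) l}

theorem mem_eigenvalueSet {a : Matrix (Fin n) (Fin n) ℝ} {l : ℝ} :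
    l ∈ eigenvalueSet a ↔ ∃ v, v ≠ 0 ∧ a *ᵥ v = l • v := hasEigenvalue_toLin'_iff

namespace ConformalFrame

variable {Y ξ : EuclideanSpace ℝ (Fin n) → (Fin (n + 1 + 2) → ℝ)}

theorem isSelfAdj_raise_blaschke (h : ConformalFrame U Y ξ) (hu : u ∈ U) :
    IsSelfAdj (inducedMetric Y u) (raise (inducedMetric Y) (blaschkeTensor Y) u) := by
  rw [IsSelfAdj, h.metric_mul_raise hu]
  ext i j
  exact h.blaschke_symm hu j i

/-- If the Blaschke tensor is parallel and has three eigenvalues, these are locally constant. -/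
theorem exists_ball_eigenvalues (h : ConformalFrame U Y ξ) (hu : u ∈ U)
    (hA : IsParallelOn U (connection (inducedMetric Y))
      (raise (inducedMetric Y) (blaschkeTensor Y)))
    (h3 : ∀ v ∈ U, (eigenvalueSet (raise (inducedMetric Y) (blaschkeTensor Y) v)).encard = 3) :
    ∃ r > 0, Metric.ball u r ⊆ U ∧ ∃ l₁ l₂ l₃ : ℝ, l₁ ≠ l₂ ∧ l₁ ≠ l₃ ∧ l₂ ≠ l₃ ∧
      ∀ v ∈ Metric.ball u r,
        cubic l₁ l₂ l₃ (raise (inducedMetric Y) (blaschkeTensor Y) v) = 0 ∧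
        eigenvalueSet (raise (inducedMetric Y) (blaschkeTensor Y) v) = {l₁, l₂, l₃} := by
  obtain ⟨r, hr, hrU⟩ := Metric.isOpen_iff.1 h.isOpen u hu
  obtain ⟨l₁, l₂, l₃, h12, h13, h23, he⟩ := Set.encard_eq_three.1 (h3 u hu)
  have ha := h.smooth_raise h.smooth_blaschke
  have hq := isSelfAdj_cubic (inducedMetric_transpose Y u) (h.isSelfAdj_raise_blaschke hu) l₁ l₂ l₃
  have hq0 : cubic l₁ l₂ l₃ (raise (inducedMetric Y) (blaschkeTensor Y) u) = 0 := by
    refine (h.isSelfAdj_raise_blaschke hu).cubic_eq_zero (h.posDef u hu) fun l v hv hl => ?_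
    have : l ∈ eigenvalueSet (raise (inducedMetric Y) (blaschkeTensor Y) u) :=
      mem_eigenvalueSet.2 ⟨v, hv, hl⟩
    rw [he] at this
    simpa using this
  refine ⟨r, hr, hrU, l₁, l₂, l₃, h12, h13, h23, fun v hv => ?_⟩
  have hsm : MatSmoothOn (Metric.ball u r) (raise (inducedMetric Y) (blaschkeTensor Y)) :=
    ha.mono hrU
  have hpar : IsParallelOn (Metric.ball u r) (connection (inducedMetric Y))
      (raise (inducedMetric Y) (blaschkeTensor Y)) := fun v hv => hA v (hrU hv)
  have hc := hsm.cubic l₁ l₂ l₃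
  have hcp := hpar.cubic Metric.isOpen_ball hsm l₁ l₂ l₃
  -- The square of the cubic in `a` is parallel, so its trace is constant, and zero at `u`.
  -- Self-adjointness then makes the cubic vanish on the whole ball.
  have htr := (hcp.mul Metric.isOpen_ball hc hc hcp).trace_eq Metric.isOpen_ball
    (convex_ball u r) (hc.mul hc) hv (Metric.mem_ball_self hr)
  rw [hq0, Matrix.mul_zero, Matrix.trace_zero] at htr
  have hv0 : cubic l₁ l₂ l₃ (raise (inducedMetric Y) (blaschkeTensor Y) v) = 0 :=
    (isSelfAdj_cubic (inducedMetric_transpose Y v) (h.isSelfAdj_raise_blaschke (hrU hv))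
      l₁ l₂ l₃).eq_zero_of_trace_mul_self (h.posDef v (hrU hv)) htr
  refine ⟨hv0, ?_⟩
  -- The vanishing cubic confines the spectrum to three numbers; the eigenvalue count excludes a
  -- proper subset.
  refine Set.Finite.eq_of_subset_of_encard_le (Set.finite_of_encard_eq_coe (h3 v (hrU hv)))
      (fun l hl => ?_) ?_
  · obtain ⟨w, hw, hlw⟩ := mem_eigenvalueSet.1 hl
    simpa using eigenvalue_of_cubic_eq_zero hv0 hw hlw
  · rw [h3 v (hrU hv), ← he, h3 u hu]

/-- Near each point b M = p with M = (l₁+l₂+l₃) - a parallel and p a nonzero constant;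
differentiating this relation gives ∇b = 0. -/
theorem isParallelOn_raise_secondForm (h : ConformalFrame U Y ξ)
    (hA : ∀ v ∈ U, ∀ i j k, covDeriv (inducedMetric Y) (blaschkeTensor Y) i j k v = 0)
    (hB : ∀ v ∈ U, secondForm Y ξ v ≠ 0)
    (h3 : ∀ v ∈ U, (eigenvalueSet (raise (inducedMetric Y) (blaschkeTensor Y) v)).encard = 3) :
    IsParallelOn U (connection (inducedMetric Y))
      (raise (inducedMetric Y) (secondForm Y ξ)) := by
  intro u hu k
  have hpar : IsParallelOn U (connection (inducedMetric Y))
      (raise (inducedMetric Y) (blaschkeTensor Y)) := fun v hv k =>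
    (h.covDeriv_eq_zero_iff hv h.smooth_blaschke k).1 fun i j => hA v hv i j k
  have hcomm : ∀ v ∈ U, raise (inducedMetric Y) (blaschkeTensor Y) v
      * raise (inducedMetric Y) (secondForm Y ξ) v = raise (inducedMetric Y) (secondForm Y ξ) v
        * raise (inducedMetric Y) (blaschkeTensor Y) v := fun v hv =>
    h.raise_commute (fun w hw => h.conformalForm_eq_zero hw (hA w hw) (hB w hw)) hv
  obtain ⟨r, hr, hrU, l₁, l₂, l₃, h12, h13, h23, hl⟩ := h.exists_ball_eigenvalues hu hpar h3
  have hub : u ∈ Metric.ball u r := Metric.mem_ball_self hr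
  set a := raise (inducedMetric Y) (blaschkeTensor Y) with ha
  set b := raise (inducedMetric Y) (secondForm Y ξ) with hb
  have hsa : MatSmoothOn (Metric.ball u r) a := (h.smooth_raise h.smooth_blaschke).mono hrU
  have hsb : MatSmoothOn (Metric.ball u r) b := (h.smooth_raise h.smooth_secondForm).mono hrU
  have hex : ∀ v ∈ Metric.ball u r, ∃ p : ℝ, p ≠ 0 ∧
      p ^ 2 = (l₁ + l₂) * (l₁ + l₃) * (l₂ + l₃) ∧
      b v * ((l₁ + l₂ + l₃) • (1 : Matrix (Fin n) (Fin n) ℝ) - a v) =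
        p • (1 : Matrix (Fin n) (Fin n) ℝ) := by
    intro v hv
    obtain ⟨hq, he⟩ := hl v hv
    refine exists_mul_eq_smul_one (h.posDef v (hrU hv)) (h.isSelfAdj_raise_blaschke (hrU hv))
      (hcomm v (hrU hv)) (fun V W Z => ?_) h12 h13 h23 (mem_eigenvalueSet.1 (by rw [he]; simp))
      (mem_eigenvalueSet.1 (by rw [he]; simp)) (mem_eigenvalueSet.1 (by rw [he]; simp)) hq
    rw [h.sum_smul_curvature (hrU hv), h.sum_smul_curvature (hrU hv)]
    simp only [Matrix.mulVec_sum, Matrix.mulVec_smul, Matrix.mulVec_mulVec]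
    refine Finset.sum_congr rfl fun i _ => Finset.sum_congr rfl fun j _ => ?_
    rw [curvature_commute h.isOpen h.smooth_connection (h.smooth_raise h.smooth_blaschke) hpar
      (hrU hv)]
  choose! p hp0 hp2 hp using hex
  set M : EuclideanSpace ℝ (Fin n) → Matrix (Fin n) (Fin n) ℝ :=
    fun v => (l₁ + l₂ + l₃) • (1 : Matrix (Fin n) (Fin n) ℝ) - a v with hM
  have hsM : MatSmoothOn (Metric.ball u r) M := (MatSmoothOn.const _).sub hsa
  -- `p` was chosen pointwise, but it is the normalized trace of b M and so smooth.
  have hsp : ContDiffOn ℝ ∞ p (Metric.ball u r) := by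
    refine ((contDiffOn_const (c := (n : ℝ)⁻¹)).mul (contDiffOn_trace (hsb.mul hsM))).congr
      fun v hv => ?_
    change p v = (n : ℝ)⁻¹ * (b v * M v).trace
    rw [hp v hv, Matrix.trace_smul, Matrix.trace_one, Fintype.card_fin, smul_eq_mul]
    field_simp [h.dim_cast_ne]
  -- Differentiate the constant p² and cancel p ≠ 0; no choice of sign of the root is needed.
  have hdp : pd k p u = 0 := by
    have hd := differentiableAt_of_contDiffOn Metric.isOpen_ball hsp hub
    have h1 := pd_mul hd hd k
    rw [pd_eq_zero_of_eqOn_const Metric.isOpen_ball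
      (fun v hv => by rw [← sq, hp2 v hv]) hub] at h1
    have h2 : p u * pd k p u = 0 := by linarith
    exact (mul_eq_zero.1 h2).resolve_left (hp0 u hub)
  have h1 : mpd k b u * M u + b u * mpd k M u = 0 := by
    rw [← mpd_mul Metric.isOpen_ball hsb hsM hub, mpd_congr Metric.isOpen_ball
      (T := fun v => p v • (1 : Matrix (Fin n) (Fin n) ℝ)) (fun v hv => hp v hv) hub,
      mpd_smul_const Metric.isOpen_ball hsp _ hub, hdp, zero_smul]
  have h2 : mpd k M u = M u * connection (inducedMetric Y) k u
      - connection (inducedMetric Y) k u * M u := by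
    rw [hM, mpd_sub Metric.isOpen_ball (MatSmoothOn.const _) hsa hub, mpd_const, hpar u hu]
    simp only [sub_mul, mul_sub, smul_mul_assoc, mul_smul_comm, mul_one, one_mul]
    abel
  have hMb : M u * b u = p u • (1 : Matrix (Fin n) (Fin n) ℝ) := by
    rw [← hp u hub]
    simp only [hM, sub_mul, mul_sub, smul_mul_assoc, mul_smul_comm, mul_one, one_mul, hcomm u hu]
  set G := connection (inducedMetric Y) k u with hG
  -- This is (∇b) M = ∇(b M) - b ∇M = 0; right multiplication by b then replaces M by the nonzero
  -- scalar p.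
  have h3 : (mpd k b u - (b u * G - G * b u)) * M u = 0 := by
    have h4 : b u * M u * G = G * (b u * M u) := by
      rw [show b u * M u = _ from hp u hub, smul_mul_assoc, mul_smul_comm, Matrix.one_mul,
        Matrix.mul_one]
    calc _ = mpd k b u * M u + b u * (M u * G - G * M u)
          + (G * (b u * M u) - b u * M u * G) := by noncomm_ring
      _ = 0 := by rw [← h2, h1, h4, sub_self, add_zero]
  have h5 : p u • (mpd k b u - (b u * G - G * b u)) = 0 := by
    calc _ = (mpd k b u - (b u * G - G * b u)) * (M u * b u) := by
          rw [hMb, mul_smul_comm, Matrix.mul_one]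
      _ = 0 := by rw [← Matrix.mul_assoc, h3, Matrix.zero_mul]
  exact sub_eq_zero.1 ((smul_eq_zero.1 h5).resolve_left (hp0 u hub))

end ConformalFrame

/-- Excludes dimension one, where the scalar curvature argument for B ≠ 0 breaks down. -/
theorem encard_eigenvalueSet_le_one (hn : n = 1) (a : Matrix (Fin n) (Fin n) ℝ) :
    (eigenvalueSet a).encard ≤ 1 := by
  subst hn
  refine Set.encard_le_one_iff.2 fun l m hl hm => ?_
  have key : ∀ l, l ∈ eigenvalueSet a → l = a 0 0 := by
    intro l hl
    obtain ⟨v, hv, h⟩ := mem_eigenvalueSet.1 hl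
    have hv0 : v 0 ≠ 0 := fun h0 => hv (funext fun i => by rw [Subsingleton.elim i 0, h0]; rfl)
    have h1 := congrFun h 0
    simp only [Matrix.mulVec, dotProduct, Finset.univ_unique, Finset.sum_singleton,
      Fin.default_eq_zero, Pi.smul_apply, smul_eq_mul] at h1
    exact (mul_right_cancel₀ hv0 h1).symm
  rw [key l hl, key m hm]

end ParallelTensors

/-! ### Canonical lifts -/

section CanonicalLifts

variable {n : ℕ} {M : Type*} [TopologicalSpace M] [ChartedSpace (EuclideanSpace ℝ (Fin n)) M]

theorem IsCanonicalLift.conformalFrame {x : M → ConformalSpace (n + 1) 1}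
    {e : OpenPartialHomeomorph M (EuclideanSpace ℝ (Fin n))}
    {U : Set (EuclideanSpace ℝ (Fin n))}
    {Y ξ : EuclideanSpace ℝ (Fin n) → (Fin (n + 1 + 2) → ℝ)}
    (hx : IsSpacelikeHypersurface x) (hn : n ≠ 0) (hY : IsCanonicalLift x e U Y)
    (hξ : IsConformalNormal U Y ξ) : ConformalFrame U Y ξ where
  isOpen := hY.1.2.1
  dim_ne := hn
  smooth := hY.1.2.2.2.1
  null u hu := by
    obtain ⟨h0, h1⟩ := hY.1.2.2.2.2 u hu
    exact (x (e.symm u)).2 (Y u) h0 h1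
  posDef u hu := hx.2 e U Y hY.1 u hu
  smoothNormal := hξ.1
  normal_normal u hu := (hξ.2 u hu).1
  normal_lift u hu := (hξ.2 u hu).2.1
  normal_conformalN u hu := (hξ.2 u hu).2.2.1
  normal_pd u hu := (hξ.2 u hu).2.2.2

/-- A zero factor would annihilate the conformal metric, which for a canonical lift is the positive
definite induced metric. The index `i` supplies a diagonal entry to test. -/
theorem IsCanonicalLift.conformalFactor_ne_zero {x : M → ConformalSpace (n + 1) 1}
    {e : OpenPartialHomeomorph M (EuclideanSpace ℝ (Fin n))}
    {U : Set (EuclideanSpace ℝ (Fin n))}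
    {Y : EuclideanSpace ℝ (Fin n) → (Fin (n + 1 + 2) → ℝ)}
    (hx : IsSpacelikeHypersurface x) (i : Fin n) (hY : IsCanonicalLift x e U Y)
    {u : EuclideanSpace ℝ (Fin n)} (hu : u ∈ U) : conformalFactor Y u ≠ 0 := by
  intro h0
  have h1 := hY.2 u hu
  rw [conformalMetric, h0, zero_smul] at h1
  have h2 := (hx.2 e U Y hY.1 u hu).diag_pos (i := i)
  rw [h1] at h2
  exact lt_irrefl _ h2

end CanonicalLifts

end ConformalGeometry

end

/-! ### Conclusion for hypersurfaces -/

theorem lemma2p3 {n : ℕ} {M : Type*} [TopologicalSpace M]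
    [ChartedSpace (EuclideanSpace ℝ (Fin n)) M] [IsManifold (𝓡 n) ∞ M]
    (x : M → ConformalGeometry.ConformalSpace (n + 1) 1)
    (hx : ConformalGeometry.IsSpacelikeHypersurface x)
    (hreg : ConformalGeometry.IsRegular x)
    (hA : ConformalGeometry.HasParallelBlaschkeTensor x)
    (h3 : ConformalGeometry.HasBlaschkeEigenvalueCount x 3) :
    ConformalGeometry.HasParallelSecondForm x := by
  open ConformalGeometry in
  intro e U Y ξ hY hξ u hu i j k
  have h : ConformalFrame U Y ξ := hY.conformalFrame hx (Fin.pos i).ne' hξ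
  have h3' : ∀ v ∈ U,
      (eigenvalueSet (raise (inducedMetric Y) (blaschkeTensor Y) v)).encard = 3 := by
    intro v hv
    have := h3 e U Y hY v hv
    rw [← hY.2 v hv] at this
    exact this
  have hn1 : n ≠ 1 := by
    intro hn
    have h4 := encard_eigenvalueSet_le_one hn (raise (inducedMetric Y) (blaschkeTensor Y) u)
    rw [h3' u hu] at h4
    exact absurd h4 (by decide)
  -- The conformal metric agrees with the induced one on the open set `U`, so the frame equations of
  -- the induced metric apply.
  rw [← covDeriv_congr h.isOpen hY.2 hu]
  refine (h.covDeriv_eq_zero_iff hu h.smooth_secondForm k).2 ?_ i j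
  refine h.isParallelOn_raise_secondForm (fun v hv i j k => ?_) (fun v hv hB => ?_) h3' u hu k
  · rw [covDeriv_congr h.isOpen hY.2 hv]
    exact hA e U Y hY v hv i j k
  · exact hY.conformalFactor_ne_zero hx i hv (h.conformalFactor_eq_zero hv hn1 hB)
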